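/- Let $V$ be a $3$-dimensional complex vector space with a Hermitian form $\langle-,-\rangle$ (linear in the first variable) of signature $++-$. For $p\in\mathbb PV$ let $\sigma p\in\{-1,0,1\}$ be the sign of $\langle p,p\rangle$; $p$ is nonisotropic if $\sigma p\neq0$. For distinct $p,q\in\mathbb PV$ let $\mathrm L(p,q)$ be the complex projective line through $p,q$; a line $\mathbb PW$ is Euclidean if the form is degenerate on $W$, and two lines are orthogonal if the polar point $\mathbb PW^\perp$ of one of them belongs to the other. Let $\Omega\subset\mathbb S^1$ be the set of cube roots of unity, $\omega=e^{2\pi i/3}$. For nonisotropic $p$ and $\alpha\in\mathbb S^1$ put $$R_\alpha^p x=(\alpha^{-2}-\alpha)\frac{\langle x,p\rangle}{\langle p,p\rangle}\,p+\alpha x,\qquad R_\alpha^p\in\mathrm{SU}(2,1).$$ Write $\alpha\sim\beta$ if $\alpha,\beta\in\mathbb S^1\setminus\Omega$ lie in a same one of the arcs $I_j=\omega^jI_0$, $j=0,1,2$, where $I_0=\{e^{i\theta}\mid 0<\theta<2\pi/3\}$. The primitive of $\alpha\in\mathbb S^1\setminus\Omega$ is the unique $a=e^{i\varphi}$, $0<\varphi<\pi/3$,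 with $a^6=\alpha^3$. The geodesic through distinct nonorthogonal points $p,q$ is the image in $\mathbb PV$ of $\mathbb Rp+\mathbb R\langle p,q\rangle q$. If $p=[v]$ is nonisotropic and $w$ is a vector orthogonal to $v$ with $\langle w,w\rangle\ne0$, then for $0\le\theta<\pi$ the oriented angle at $p$ from the geodesic $\mathbb P(\mathbb Rv+\mathbb Rw)$ to the geodesic $\mathbb P(\mathbb Rv+\mathbb Re^{i\theta}w)$ is $\theta$. If $p,q$ are nonorthogonal points of the same nonzero signature, the segment $\mathrm G[p,q]$ is the arc from $p$ to $q$ of the geodesic through $p,q$ that contains no point orthogonal to $p$ (and $\mathrm G[p,p]=\{p\}$). For distinct nonisotropic nonorthogonal $p_1,p_2$ with noneuclidean $\mathrm L(p_1,p_2)$ and $\alpha_1,\alpha_2\in\mathbb S^1\setminus\Omega$ with primitives $a_1,a_2$, the geodesics associated to $R=R_{\alpha_2}^{p_2}R_{\alpha_1}^{p_1}$ are the geodesic $G$ through $p_1,p_2$ and the geodesics $G_i\ni p_i$ in $\mathrm L(p_1,p_2)$ such that $\angle_{p_1}G_1G=\operatorname{Arg}(a_1^3)$ and $\angle_{p_2}GG_2=\operatorname{Arg}(a_2^3)$.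 A relation $R_{\alpha_2}^{p_2}R_{\alpha_1}^{p_1}=R_{\alpha_2}^{Cp_2}R_{\alpha_1}^{Cp_1}$, where $C\in\mathrm{SU}(2,1)$ commutes with $R_{\alpha_2}^{p_2}R_{\alpha_1}^{p_1}$, is called a bending relation. A relation $R:=R_{\alpha_2}^{p_2}R_{\alpha_1}^{p_1}=R_{\beta_2}^{q_2}R_{\beta_1}^{q_1}$ (where $p_1,p_2$ and $q_1,q_2$ are pairs of distinct nonisotropic nonorthogonal points spanning noneuclidean lines, and $\alpha_i,\beta_i\in\mathbb S^1\setminus\Omega$) is called an $f$-bending relation if, for $i=1,2$: $q_i\in G_i$, where $G,G_1,G_2$ are the geodesics associated to $R_{\alpha_2}^{p_2}R_{\alpha_1}^{p_1}$; $\sigma q_i=\sigma p_i$ and $\langle p_i,q_i\rangle\ne0$; $\alpha_1\alpha_2=\beta_1\beta_2$ and $\alpha_i\sim\beta_i$; and $\mathrm G[p_i,q_i]$ contains no fixed point of $R$ in $\mathbb PV$. **Theorem.** Let $p_1,p_2$ and $q_1,q_2$ be pairs of distinct nonisotropic nonorthogonal points with $\sigma p_i=\sigma q_i$, and let $\alpha_i,\beta_i\in\mathbb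 S^1\setminus\Omega$ with $\alpha_i\sim\beta_i$, $i=1,2$. Assume that the lines $\mathrm L(p_1,p_2)$ and $\mathrm L(q_1,q_2)$ are noneuclidean and not orthogonal to each other. If $R_{\alpha_2}^{p_2}R_{\alpha_1}^{p_1}=R_{\beta_2}^{q_2}R_{\beta_1}^{q_1}$, then this relation follows from bending and $f$-bending relations: there is a finite sequence of tuples from $(p_1,p_2,\alpha_1,\alpha_2)$ to $(q_1,q_2,\beta_1,\beta_2)$ in which every tuple is obtained from the preceding one by a bending relation or by an $f$-bending relation. -/

import Mathlib

open scoped LinearAlgebra.Projectivization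

noncomputable section

namespace ComplexHyperbolic

/-! ### Parameters -/

/-- The set `Ω` of cube roots of unity in the unit circle. -/
def Omega : Set Circle := {ζ | ζ ^ 3 = 1}

/-- The open arcs `I₀ = {exp (iθ) | 0 < θ < 2π/3}`, `I₁ = ω I₀`, `I₂ = ω² I₀`, where
`ω = exp (2πi/3)`. -/
def arc (j : Fin 3) : Set Circle :=
  {α | ∃ θ : ℝ, 0 < θ ∧ θ < 2 * Real.pi / 3 ∧
    α = Circle.exp (2 * Real.pi / 3) ^ (j : ℕ) * Circle.exp θ}

/-- `α ∼ β`: the two parameters lie in a same arc `I_j`. -/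
def SameComponent (α β : Circle) : Prop := ∃ j : Fin 3, α ∈ arc j ∧ β ∈ arc j

/-- The open arc `J` from `1` to `-ω² = exp (πi/3)`. -/
def arcJ : Set Circle := {a | ∃ θ : ℝ, 0 < θ ∧ θ < Real.pi / 3 ∧ a = Circle.exp θ}

/-- `a` is the primitive of the parameter `α`: the unique `a ∈ J` with `(a²)³ = α³`. -/
def IsPrimitive (a α : Circle) : Prop := a ∈ arcJ ∧ (a ^ 2) ^ 3 = α ^ 3

variable {V : Type*} [AddCommGroup V] [Module ℂ V]

/-! ### The Hermitian space and its projective plane -/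

/-- The sesquilinear form `⟨v, w⟩ = h v w`, linear in `v` and conjugate-linear in `w`, is a
Hermitian form of signature `++-` on a three-dimensional space: it is given by
`diag (1, 1, -1)` in some basis. -/
def HasSignatureTwoOne (h : V →ₗ[ℂ] V →ₗ⋆[ℂ] ℂ) : Prop :=
  ∃ b : Module.Basis (Fin 3) ℂ V, ∀ i j : Fin 3,
    h (b i) (b j) = if i = j then (![1, 1, -1] : Fin 3 → ℂ) i else 0

/-- The signature `σ p ∈ {-1, 0, 1}` of a point: the sign of `⟨p, p⟩`, which does not depend on
the representative. -/
def signature (h : V →ₗ[ℂ] V →ₗ⋆[ℂ] ℂ) (p : ℙ ℂ V) : SignType :=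
  SignType.sign (h p.rep p.rep).re

/-- The points `p` and `q` are orthogonal. -/
def Orthogonal (h : V →ₗ[ℂ] V →ₗ⋆[ℂ] ℂ) (p q : ℙ ℂ V) : Prop := h p.rep q.rep = 0

/-- The two-dimensional subspace whose projectivization is the complex line `L(p, q)`. -/
def line (p q : ℙ ℂ V) : Submodule ℂ V := p.submodule ⊔ q.submodule

/-- The complex line `ℙW` is Euclidean: the form is degenerate on `W`. (For a form of signature
`++-` and a two-dimensional `W`, this says that the restricted form has signature `+0`.) -/
def IsEuclidean (h : V →ₗ[ℂ] V →ₗ⋆[ℂ] ℂ) (W : Submodule ℂ V) : Prop :=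
  ∃ v ∈ W, v ≠ 0 ∧ ∀ w ∈ W, h v w = 0

/-- The complex lines `ℙW₁` and `ℙW₂` are orthogonal: the polar point `ℙW₁^⊥` of the first one
belongs to the second one. -/
def OrthogonalLines (h : V →ₗ[ℂ] V →ₗ⋆[ℂ] ℂ) (W₁ W₂ : Submodule ℂ V) : Prop :=
  ∀ c : V, (∀ w ∈ W₁, h c w = 0) → c ∈ W₂

/-- The group `SU(2,1)` of linear automorphisms of determinant one preserving the form. -/
def SU (h : V →ₗ[ℂ] V →ₗ⋆[ℂ] ℂ) : Subgroup (V ≃ₗ[ℂ] V) where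
  carrier := {C | (∀ v w : V, h (C v) (C w) = h v w) ∧ LinearEquiv.det C = 1}
  mul_mem' := by
    rintro A B ⟨hA, dA⟩ ⟨hB, dB⟩
    exact ⟨fun v w => by simp [LinearEquiv.mul_apply, hA, hB], by simp [dA, dB]⟩
  one_mem' := ⟨fun v w => rfl, map_one _⟩
  inv_mem' := by
    rintro A ⟨hA, dA⟩
    refine ⟨fun v w => ?_, by simp [dA]⟩
    rw [← hA]
    congr 2 <;> exact LinearEquiv.apply_symm_apply A _

/-- The image of a point under a linear automorphism. -/
def act (C : V ≃ₗ[ℂ] V) (p : ℙ ℂ V) : ℙ ℂ V :=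
  Projectivization.map (C : V →ₗ[ℂ] V) C.injective p

/-- The special elliptic isometry with centre `p` and parameter `α`,
`x ↦ (α⁻² - α) (⟨x, p⟩ / ⟨p, p⟩) p + α x`; it does not depend on the representative of `p`. -/
def specialElliptic (h : V →ₗ[ℂ] V →ₗ⋆[ℂ] ℂ) (α : Circle) (p : ℙ ℂ V) : Module.End ℂ V where
  toFun x := (((α : ℂ) ^ 2)⁻¹ - α) • (h x p.rep / h p.rep p.rep) • p.rep + (α : ℂ) • x
  map_add' x y := by
    simp only [map_add, LinearMap.add_apply, add_div, add_smul, smul_add]; abel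
  map_smul' c x := by
    simp only [map_smul, LinearMap.smul_apply, smul_add, smul_smul, RingHom.id_apply,
      smul_eq_mul]
    congr 2 <;> ring

/-- The point `x` is fixed by `R`: its representatives are eigenvectors of `R`. -/
def IsFixedPoint (R : Module.End ℂ V) (x : ℙ ℂ V) : Prop :=
  ∃ μ : ℂ, Module.End.HasEigenvector R μ x.rep

/-! ### Geodesics, angles and segments -/

/-- The image in the projective plane of the real subspace `ℝv + ℝw`. -/
def realSpan (v w : V) : Set (ℙ ℂ V) :=
  {r | ∃ x y : ℝ, ∃ hne : (x : ℂ) • v + (y : ℂ) • w ≠ 0, r = Projectivization.mk ℂ _ hne}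

/-- The (extended) geodesic through the distinct nonorthogonal points `p` and `q`: the
projectivization of `ℝp + ℝ⟨p, q⟩q`. -/
def geodesic (h : V →ₗ[ℂ] V →ₗ⋆[ℂ] ℂ) (p q : ℙ ℂ V) : Set (ℙ ℂ V) :=
  realSpan p.rep (h p.rep q.rep • q.rep)

/-- `G` and `G'` are geodesics in a same noneuclidean complex line, they meet at the nonisotropic
point `p`, and the counterclockwise oriented angle from `G` to `G'` at `p` is `θ ∈ [0, π)`.

A geodesic through `p = [v]` is the projectivization of `ℝv + ℝw` with `w ≠ 0` orthogonal to `v`;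
its tangent direction at `p` is the real line spanned by the linear map `v ↦ w` in the complex line
`Lin (ℂv, v^⊥ ∩ L)`, the tangent space at `p` of the complex line `L`. -/
def HasAngle (h : V →ₗ[ℂ] V →ₗ⋆[ℂ] ℂ) (p : ℙ ℂ V) (G G' : Set (ℙ ℂ V)) (θ : ℝ) : Prop :=
  0 ≤ θ ∧ θ < Real.pi ∧ ∃ (v w : V) (hv : v ≠ 0), Projectivization.mk ℂ v hv = p ∧
    h v v ≠ 0 ∧ h w w ≠ 0 ∧ h v w = 0 ∧
    G = realSpan v w ∧ G' = realSpan v ((Circle.exp θ : ℂ) • w)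

/-- The geodesic segment from `p` to `q`, for nonorthogonal `p`, `q` of a same nonzero signature:
the arc of the geodesic through `p` and `q` that joins these points and does not contain the point
orthogonal to `p`. Choosing representatives `v`, `w` of `p`, `q` with `⟨v, w⟩` real and of the same
sign as `⟨v, v⟩`, the two arcs from `p` to `q` consist of the points `[x v + y w]` and
`[x v - y w]`, with `x, y ≥ 0` not both zero, and `x v + y w` is never orthogonal to `v`.
The segment from `p` to itself is `{p}`. -/
def geodesicSegment (h : V →ₗ[ℂ] V →ₗ⋆[ℂ] ℂ) (p q : ℙ ℂ V) : Set (ℙ ℂ V) :=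
  {r | ∃ (v w : V) (hv : v ≠ 0) (hw : w ≠ 0),
    Projectivization.mk ℂ v hv = p ∧ Projectivization.mk ℂ w hw = q ∧
    (h v w).im = 0 ∧ 0 < (h v w).re * (h v v).re ∧
    ∃ x y : ℝ, 0 ≤ x ∧ 0 ≤ y ∧ ∃ hne : (x : ℂ) • v + (y : ℂ) • w ≠ 0,
      r = Projectivization.mk ℂ _ hne}

/-! ### Products of two special elliptic isometries, bendings and f-bendings -/

variable (V) in
/-- The data (centres and parameters) of a product of two special elliptic isometries. -/
structure Config where
  p₁ : ℙ ℂ V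
  p₂ : ℙ ℂ V
  α₁ : Circle
  α₂ : Circle

/-- The product `R_{α₂}^{p₂} R_{α₁}^{p₁}`. -/
def Config.prod (h : V →ₗ[ℂ] V →ₗ⋆[ℂ] ℂ) (X : Config V) : Module.End ℂ V :=
  specialElliptic h X.α₂ X.p₂ * specialElliptic h X.α₁ X.p₁

/-- The centres are distinct, nonisotropic and nonorthogonal, they span a noneuclidean complex line,
and the parameters are not cube roots of unity. -/
structure Config.Generic (h : V →ₗ[ℂ] V →ₗ⋆[ℂ] ℂ) (X : Config V) : Prop where
  ne : X.p₁ ≠ X.p₂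
  nonisotropic₁ : signature h X.p₁ ≠ 0
  nonisotropic₂ : signature h X.p₂ ≠ 0
  nonorthogonal : ¬ Orthogonal h X.p₁ X.p₂
  noneuclidean : ¬ IsEuclidean h (line X.p₁ X.p₂)
  param₁ : X.α₁ ∉ Omega
  param₂ : X.α₂ ∉ Omega

/-- `G`, `G₁`, `G₂` are the geodesics associated to `R_{α₂}^{p₂} R_{α₁}^{p₁}`: `G` is the geodesic
through `p₁`, `p₂`, and `G_i` is the geodesic through `p_i`, in the complex line `L(p₁, p₂)`, such
that `∠_{p₁} G₁ G = Arg (a₁³)` and `∠_{p₂} G G₂ = Arg (a₂³)`, where `a_i` is the primitive of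
`α_i`. -/
def Config.AssociatedGeodesics (h : V →ₗ[ℂ] V →ₗ⋆[ℂ] ℂ) (X : Config V)
    (G G₁ G₂ : Set (ℙ ℂ V)) : Prop :=
  G = geodesic h X.p₁ X.p₂ ∧ ∃ a₁ a₂ : Circle,
    IsPrimitive a₁ X.α₁ ∧ IsPrimitive a₂ X.α₂ ∧
    HasAngle h X.p₁ G₁ G (Complex.arg ((a₁ : ℂ) ^ 3)) ∧
    HasAngle h X.p₂ G G₂ (Complex.arg ((a₂ : ℂ) ^ 3))

/-- `R_{α₂}^{p₂} R_{α₁}^{p₁} = R_{α₂}^{C p₂} R_{α₁}^{C p₁}` with `C` in the centralizer of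
`R_{α₂}^{p₂} R_{α₁}^{p₁}` in `SU(2,1)`: a bending relation. -/
def IsBending (h : V →ₗ[ℂ] V →ₗ⋆[ℂ] ℂ) (X Y : Config V) : Prop :=
  ∃ C ∈ SU h, (C : V →ₗ[ℂ] V) ∘ₗ X.prod h = X.prod h ∘ₗ (C : V →ₗ[ℂ] V) ∧
    Y = ⟨act C X.p₁, act C X.p₂, X.α₁, X.α₂⟩

/-- `R_{α₂}^{p₂} R_{α₁}^{p₁} = R_{β₂}^{q₂} R_{β₁}^{q₁}` is an f-bending relation. -/
structure IsFBending (h : V →ₗ[ℂ] V →ₗ⋆[ℂ] ℂ) (X Y : Config V) : Prop where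
  generic_left : X.Generic h
  generic_right : Y.Generic h
  relation : X.prod h = Y.prod h
  mem_geodesics : ∃ G G₁ G₂ : Set (ℙ ℂ V),
    X.AssociatedGeodesics h G G₁ G₂ ∧ Y.p₁ ∈ G₁ ∧ Y.p₂ ∈ G₂
  signature₁ : signature h Y.p₁ = signature h X.p₁
  signature₂ : signature h Y.p₂ = signature h X.p₂
  nonorthogonal₁ : ¬ Orthogonal h X.p₁ Y.p₁
  nonorthogonal₂ : ¬ Orthogonal h X.p₂ Y.p₂
  mul_eq : X.α₁ * X.α₂ = Y.α₁ * Y.α₂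
  same₁ : SameComponent X.α₁ Y.α₁
  same₂ : SameComponent X.α₂ Y.α₂
  not_fixed₁ : ∀ x ∈ geodesicSegment h X.p₁ Y.p₁, ¬ IsFixedPoint (X.prod h) x
  not_fixed₂ : ∀ x ∈ geodesicSegment h X.p₂ Y.p₂, ¬ IsFixedPoint (X.prod h) x

/-- The relation `X.prod h = Y.prod h` follows from bending and f-bending relations: `Y` is obtained
from `X` by a finite sequence of bendings and f-bendings. -/
def FollowsFromBendings (h : V →ₗ[ℂ] V →ₗ⋆[ℂ] ℂ) (X Y : Config V) : Prop :=
  Relation.ReflTransGen (fun X' Y' => IsBending h X' Y' ∨ IsFBending h X' Y') X Y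

end ComplexHyperbolic

end

noncomputable section

namespace ComplexHyperbolic

open scoped ComplexConjugate

variable {V : Type*} [AddCommGroup V] [Module ℂ V]

/-! ### Hermitian linear algebra -/

/-! Up to a unimodular scalar, `R_α` with primitive `a` is the `rotation` by `u = a³`, which
multiplies the centre by `conj u` and its orthogonal complement by `u`; moreover `u` lies in the
open upper half circle. On the plane `W` of the two centres, the product `S` of two rotations is an
isometry of determinant 1 with real trace `2τ`. Hence `A = -i(S - τ)` is selfadjoint on `W`, and
Cayley–Hamilton gives `A² = κ = 1 - τ²`. Everything then takes place in the commutative algebra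
`ℂ[A]`, with the involution conjugating coefficients and fixing `A`. Its unitary elements extend to
isometries commuting with `S` (bendings), and the associated geodesics are `G_i = ℙ(ℝ[A] vᵢ)`
(`mem_realSpan₁`, `mem_realSpan₂`). The norm of `x + yA` in `ℝ[A]` is `(x + yA)(x - yA) = x² - κy²`.

Let the same product have a second decomposition with centres `q₁, q₂`. The polar point of each line
is an eigenvector of the product. As the lines are not orthogonal, the eigenvalues agree, and this
eigenvalue does not occur on `W`, so the lines coincide (`same_plane`). The arcs `I_j` then exclude
a sign ambiguity in the half-angles, so both products of rotations equal `S`. Since `v₁` is not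
fixed by `S`, `q₁ = (z + wA)v₁`. A polar decomposition in `ℂ[A]` (`exists_unitary_coeffs`) provides
a unitary element that moves `q₁` to `(x + yA)v₁` with `x`, `y` real and positive norm; equality of
signatures is what makes this possible. Then `q₂` is automatically moved to a multiple of an element
of positive norm of `ℝ[A]` applied to `v₂` (`second_center`), because each centre determines the
other one through `A`.

So an isometry `D` commuting with `S` puts the second pair of centres on `G₁` and `G₂`. A fixed
point in `ℙ(ℝ[A]vᵢ)` has norm zero, whereas norms stay positive along the segments
(`IsAdapted.segment`), so no fixed point is met. Thus the given configuration is f-bent to the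
`D`-image of the target, and `D⁻¹` is the remaining bending. -/

theorem apply_smul_smul (h : V →ₗ[ℂ] V →ₗ⋆[ℂ] ℂ) (a b : ℂ) (x y : V) :
    h (a • x) (b • y) = a * conj b * h x y := by
  simp [LinearMap.map_smulₛₗ]; ring

theorem HasSignatureTwoOne.conj_symm {h : V →ₗ[ℂ] V →ₗ⋆[ℂ] ℂ} (hh : HasSignatureTwoOne h)
    (x y : V) : conj (h x y) = h y x := by
  obtain ⟨b, hb⟩ := hh
  rw [← b.sum_repr x, ← b.sum_repr y]
  simp only [map_add, LinearMap.add_apply, map_smul, LinearMap.smul_apply, LinearMap.map_smulₛₗ,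
    hb, smul_eq_mul, Fin.sum_univ_three]
  simp
  ring

theorem HasSignatureTwoOne.nondegenerate {h : V →ₗ[ℂ] V →ₗ⋆[ℂ] ℂ} (hh : HasSignatureTwoOne h)
    {x : V} (hx : ∀ y, h x y = 0) : x = 0 := by
  obtain ⟨b, hb⟩ := hh
  have key : ∀ j, b.repr x j = 0 := by
    intro j
    have := hx (b j)
    rw [← b.sum_repr x] at this
    simp only [map_add, LinearMap.add_apply, map_smul, LinearMap.smul_apply, hb, smul_eq_mul,
      Fin.sum_univ_three] at this
    fin_cases j <;> simpa using this
  rw [← b.sum_repr x]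
  simp [key]

theorem HasSignatureTwoOne.finrank {h : V →ₗ[ℂ] V →ₗ⋆[ℂ] ℂ} (hh : HasSignatureTwoOne h) :
    Module.finrank ℂ V = 3 := by
  obtain ⟨b, -⟩ := hh
  simpa using Module.finrank_eq_card_basis b

theorem HasSignatureTwoOne.self_real {h : V →ₗ[ℂ] V →ₗ⋆[ℂ] ℂ} (hh : HasSignatureTwoOne h)
    (x : V) : (((h x x).re : ℝ) : ℂ) = h x x :=
  Complex.conj_eq_iff_re.1 (hh.conj_symm x x)

/-- Taking determinants in the Gram identity `Mᵀ J conj(M) = J` leaves `|det M|² = 1`. -/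
theorem HasSignatureTwoOne.norm_det {h : V →ₗ[ℂ] V →ₗ⋆[ℂ] ℂ} (hh : HasSignatureTwoOne h)
    {C : V →ₗ[ℂ] V} (hC : ∀ x y, h (C x) (C y) = h x y) : ‖LinearMap.det C‖ = 1 := by
  obtain ⟨b, hb⟩ := hh
  set M := LinearMap.toMatrix b b C with hM
  set J : Matrix (Fin 3) (Fin 3) ℂ := Matrix.diagonal (![1, 1, -1] : Fin 3 → ℂ) with hJ
  have hC' : ∀ i, C (b i) = ∑ k, M k i • b k := fun i => by
    rw [hM, ← b.sum_repr (C (b i))]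
    simp [LinearMap.toMatrix_apply]
  have e : M.transpose * J * M.map conj = J := by
    ext i j
    have := hC (b i) (b j)
    rw [hC', hC', hb] at this
    simp only [map_add, LinearMap.add_apply, map_smul, LinearMap.smul_apply, LinearMap.map_smulₛₗ,
      hb, smul_eq_mul, Fin.sum_univ_three] at this
    simp only [hJ, Matrix.diagonal_apply, ← this, Matrix.mul_apply, Fin.sum_univ_three,
      Matrix.transpose_apply, Matrix.map_apply]
    simp
    ring
  have hdet := congrArg Matrix.det e
  have hmap : (M.map conj).det = conj M.det := ((starRingEnd ℂ).map_det M).symm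
  rw [Matrix.det_mul, Matrix.det_mul, Matrix.det_transpose, hmap] at hdet
  have hJd : J.det = -1 := by simp [hJ, Matrix.det_diagonal, Fin.prod_univ_three]
  rw [hJd] at hdet
  have h1 : M.det * conj M.det = 1 := by linear_combination -hdet
  rw [Complex.mul_conj, Complex.normSq_eq_norm_sq] at h1
  have h2 : ‖M.det‖ ^ 2 = 1 := by exact_mod_cast h1
  rw [← LinearMap.det_toMatrix b C, ← hM]
  nlinarith [norm_nonneg M.det]

/-- A linear isometry becomes an element of `SU(2,1)` after multiplication by a scalar. -/
theorem HasSignatureTwoOne.exists_mem_SU {h : V →ₗ[ℂ] V →ₗ⋆[ℂ] ℂ} (hh : HasSignatureTwoOne h)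
    {C : V →ₗ[ℂ] V} (hC : ∀ x y, h (C x) (C y) = h x y) :
    ∃ (D : V ≃ₗ[ℂ] V) (l : ℂ), D ∈ SU h ∧ l ≠ 0 ∧ ∀ x, D x = l • C x := by
  have hd := hh.norm_det hC
  -- In dimension 3 a scalar `l` multiplies the determinant by `l³`; it is unimodular because the
  -- determinant is.
  obtain ⟨l, hl⟩ : ∃ l : ℂ, l ^ 3 = (LinearMap.det C)⁻¹ :=
    IsAlgClosed.exists_pow_nat_eq _ (by norm_num)
  have hd0 : LinearMap.det C ≠ 0 := fun h0 => by simp [h0] at hd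
  have hln : ‖l‖ = 1 := by
    have : ‖l‖ ^ 3 = 1 := by rw [← norm_pow, hl, norm_inv, hd, inv_one]
    exact (pow_eq_one_iff_of_nonneg (norm_nonneg l) (by norm_num)).1 this
  have hl0 : l ≠ 0 := fun h0 => by simp [h0] at hln
  have hll : l * conj l = 1 := by
    rw [Complex.mul_conj, Complex.normSq_eq_norm_sq, hln]; norm_num
  have hfin : FiniteDimensional ℂ V := Module.finite_of_finrank_pos (by rw [hh.finrank]; norm_num)
  have hdet : LinearMap.det (l • C) = 1 := by
    rw [LinearMap.det_smul, hh.finrank, hl, inv_mul_cancel₀ hd0]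
  refine ⟨LinearEquiv.ofIsUnitDet (f := l • C) (v := Module.finBasis ℂ V)
    (v' := Module.finBasis ℂ V) ?_, l, ⟨?_, ?_⟩, hl0, fun x => rfl⟩
  · rw [LinearMap.det_toMatrix, hdet]; exact isUnit_one
  · intro x y
    change h (l • C x) (l • C y) = _
    rw [apply_smul_smul, hC, hll, one_mul]
  · ext
    rw [LinearEquiv.coe_det]
    exact hdet

/-- A nondegenerate plane `ℂv₁ + ℂv₂` has a nonisotropic polar vector `c` and is equal to the
orthogonal complement of `c`. -/
theorem HasSignatureTwoOne.exists_polar {h : V →ₗ[ℂ] V →ₗ⋆[ℂ] ℂ} (hh : HasSignatureTwoOne h)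
    {v₁ v₂ : V} (hD : h v₁ v₁ * h v₂ v₂ - h v₁ v₂ * h v₂ v₁ ≠ 0) :
    ∃ c : V, h c c ≠ 0 ∧ h v₁ c = 0 ∧ h v₂ c = 0 ∧
      ∀ x, h x c = 0 → ∃ a b : ℂ, x = a • v₁ + b • v₂ := by
  have hfin : FiniteDimensional ℂ V := Module.finite_of_finrank_pos (by rw [hh.finrank]; norm_num)
  obtain ⟨u, hu⟩ : ∃ u, u ∉ Submodule.span ℂ (Set.range ![v₁, v₂]) := by
    by_contra! hc
    have h1 := finrank_range_le_card (R := ℂ) ![v₁, v₂]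
    rw [Set.finrank, Submodule.eq_top_iff'.2 hc, finrank_top, hh.finrank] at h1
    simp at h1
  set d := h v₁ v₁ * h v₂ v₂ - h v₁ v₂ * h v₂ v₁ with hd
  -- Cramer's rule for the Gram system: `a v₁ + b v₂` is the orthogonal projection of `u` to the
  -- plane.
  set a := (h u v₁ * h v₂ v₂ - h u v₂ * h v₂ v₁) / d with ha
  set b := (h u v₂ * h v₁ v₁ - h u v₁ * h v₁ v₂) / d with hb
  set c := u - a • v₁ - b • v₂ with hc
  have hc1 : h c v₁ = 0 := by
    simp only [hc, map_sub, map_smul, LinearMap.sub_apply, LinearMap.smul_apply, smul_eq_mul, ha, hb]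
    field_simp
    rw [hd]; ring
  have hc2 : h c v₂ = 0 := by
    simp only [hc, map_sub, map_smul, LinearMap.sub_apply, LinearMap.smul_apply, smul_eq_mul, ha, hb]
    field_simp
    rw [hd]; ring
  have h1c : h v₁ c = 0 := by rw [← hh.conj_symm, hc1, map_zero]
  have h2c : h v₂ c = 0 := by rw [← hh.conj_symm, hc2, map_zero]
  have hc0 : c ≠ 0 := by
    intro h0
    refine hu ?_
    rw [Matrix.range_cons_cons_empty, Submodule.mem_span_pair]
    refine ⟨a, b, ?_⟩
    rw [hc, sub_sub, sub_eq_zero] at h0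
    exact h0.symm
  have hli : LinearIndependent ℂ ![v₁, v₂, c] := by
    rw [Fintype.linearIndependent_iff]
    intro g hg
    simp only [Fin.sum_univ_three, Matrix.cons_val_zero, Matrix.cons_val_one, Matrix.cons_val_two,
      Matrix.head_cons, Matrix.tail_cons] at hg
    have e1 := congrArg (fun x => h x v₁) hg
    have e2 := congrArg (fun x => h x v₂) hg
    simp only [map_add, map_smul, LinearMap.add_apply, LinearMap.smul_apply, smul_eq_mul, hc1, hc2,
      map_zero, LinearMap.zero_apply, mul_zero, add_zero] at e1 e2
    have g0 : g 0 = 0 := by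
      have : g 0 * d = 0 := by rw [hd]; linear_combination e1 * h v₂ v₂ - e2 * h v₂ v₁
      simpa [hD] using this
    have g1 : g 1 = 0 := by
      have : g 1 * d = 0 := by rw [hd]; linear_combination e2 * h v₁ v₁ - e1 * h v₁ v₂
      simpa [hD] using this
    have g2 : g 2 = 0 := by simpa [g0, g1, hc0] using hg
    intro i; fin_cases i <;> assumption
  have hspan : ∀ x, ∃ a b z : ℂ, x = a • v₁ + b • v₂ + z • c := by
    intro x
    have ht := hli.span_eq_top_of_card_eq_finrank' (by simp [hh.finrank])
    have hx : x ∈ Submodule.span ℂ (Set.range ![v₁, v₂, c]) := by rw [ht]; trivial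
    obtain ⟨g, hg⟩ := (Submodule.mem_span_range_iff_exists_fun ℂ).1 hx
    refine ⟨g 0, g 1, g 2, ?_⟩
    rw [← hg, Fin.sum_univ_three]
    rfl
  -- An isotropic `c` would be orthogonal to the whole basis `v₁, v₂, c`.
  have hcc : h c c ≠ 0 := by
    intro h0
    refine hc0 (hh.nondegenerate fun y => ?_)
    obtain ⟨a, b, z, rfl⟩ := hspan y
    simp [hc1, hc2, h0, LinearMap.map_smulₛₗ]
  refine ⟨c, hcc, h1c, h2c, fun x hx => ?_⟩
  obtain ⟨a, b, z, rfl⟩ := hspan x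
  refine ⟨a, b, ?_⟩
  have : z = 0 := by simpa [h1c, h2c, hcc] using hx
  simp [this]

/-! ### Representatives -/

theorem exists_smul_of_mk_eq {v w : V} {hv : v ≠ 0} {hw : w ≠ 0}
    (e : Projectivization.mk ℂ v hv = Projectivization.mk ℂ w hw) :
    ∃ a : ℂ, a ≠ 0 ∧ v = a • w := by
  obtain ⟨a, ha⟩ := (Projectivization.mk_eq_mk_iff ℂ v w hv hw).1 e
  exact ⟨a, a.ne_zero, ha.symm⟩

theorem exists_rep_mk (v : V) (hv : v ≠ 0) :
    ∃ a : ℂ, a ≠ 0 ∧ (Projectivization.mk ℂ v hv).rep = a • v := by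
  apply exists_smul_of_mk_eq (hv := Projectivization.rep_nonzero _) (hw := hv)
  exact Projectivization.mk_rep _

theorem signature_mk {h : V →ₗ[ℂ] V →ₗ⋆[ℂ] ℂ} (v : V) (hv : v ≠ 0) :
    signature h (Projectivization.mk ℂ v hv) = SignType.sign (h v v).re := by
  obtain ⟨a, ha, e⟩ := exists_rep_mk v hv
  rw [signature, e, apply_smul_smul, Complex.mul_conj, Complex.re_ofReal_mul, sign_mul,
    sign_pos (Complex.normSq_pos.2 ha), one_mul]

theorem orthogonal_mk {h : V →ₗ[ℂ] V →ₗ⋆[ℂ] ℂ} (v w : V) (hv : v ≠ 0) (hw : w ≠ 0) :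
    Orthogonal h (Projectivization.mk ℂ v hv) (Projectivization.mk ℂ w hw) ↔ h v w = 0 := by
  obtain ⟨a, ha, e⟩ := exists_rep_mk v hv
  obtain ⟨b, hb, e'⟩ := exists_rep_mk w hw
  rw [Orthogonal, e, e', apply_smul_smul]
  simp [ha, hb]

theorem isFixedPoint_mk {R : Module.End ℂ V} (v : V) (hv : v ≠ 0) :
    IsFixedPoint R (Projectivization.mk ℂ v hv) ↔ ∃ μ : ℂ, R v = μ • v := by
  obtain ⟨a, ha, e⟩ := exists_rep_mk v hv
  refine exists_congr fun μ => ?_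
  rw [Module.End.hasEigenvector_iff, Module.End.mem_eigenspace_iff, e]
  constructor
  · rintro ⟨h1, -⟩
    rw [map_smul, smul_comm] at h1
    exact smul_right_injective V ha h1
  · intro h1
    exact ⟨by rw [map_smul, h1, smul_comm], smul_ne_zero ha hv⟩

theorem specialElliptic_mk {h : V →ₗ[ℂ] V →ₗ⋆[ℂ] ℂ} (α : Circle) (v : V) (hv : v ≠ 0) (x : V) :
    specialElliptic h α (Projectivization.mk ℂ v hv) x =
      (((α : ℂ) ^ 2)⁻¹ - α) • (h x v / h v v) • v + (α : ℂ) • x := by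
  obtain ⟨a, ha, e⟩ := exists_rep_mk v hv
  change (((α : ℂ) ^ 2)⁻¹ - α) • (h x (Projectivization.mk ℂ v hv).rep /
    h (Projectivization.mk ℂ v hv).rep (Projectivization.mk ℂ v hv).rep) •
      (Projectivization.mk ℂ v hv).rep + (α : ℂ) • x = _
  have ha' : conj a ≠ 0 := by simpa using ha
  rw [e, apply_smul_smul, LinearMap.map_smulₛₗ]
  congr 2
  rw [smul_smul]
  congr 1
  rw [smul_eq_mul]
  by_cases h0 : h v v = 0
  · simp [h0]
  · field_simp

theorem act_mk (C : V ≃ₗ[ℂ] V) (v : V) (hv : v ≠ 0) :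
    act C (Projectivization.mk ℂ v hv) =
      Projectivization.mk ℂ (C v) (C.map_ne_zero_iff.2 hv) := rfl

theorem mem_line_mk {x v w : V} {hv : v ≠ 0} {hw : w ≠ 0} :
    x ∈ line (Projectivization.mk ℂ v hv) (Projectivization.mk ℂ w hw) ↔
      ∃ a b : ℂ, x = a • v + b • w := by
  simp only [line, Projectivization.submodule_mk, Submodule.mem_sup, Submodule.mem_span_singleton]
  constructor
  · rintro ⟨_, ⟨a, rfl⟩, _, ⟨b, rfl⟩, rfl⟩
    exact ⟨a, b, rfl⟩
  · rintro ⟨a, b, rfl⟩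
    exact ⟨_, ⟨a, rfl⟩, _, ⟨b, rfl⟩, rfl⟩

/-! ### Rotations and normalized pairs of centres -/

/-- The isometry that multiplies `v` by `conj u` and `v^⊥` by `u`. -/
def rotation (h : V →ₗ[ℂ] V →ₗ⋆[ℂ] ℂ) (u : ℂ) (v : V) : Module.End ℂ V where
  toFun x := u • x + ((conj u - u) * (h x v / h v v)) • v
  map_add' x y := by
    simp only [map_add, LinearMap.add_apply, add_div, mul_add, add_smul, smul_add]; abel
  map_smul' c x := by
    simp only [map_smul, LinearMap.smul_apply, smul_add, smul_smul, RingHom.id_apply,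
      smul_eq_mul]
    congr 2 <;> ring

theorem rotation_apply (h : V →ₗ[ℂ] V →ₗ⋆[ℂ] ℂ) (u : ℂ) (v x : V) :
    rotation h u v x = u • x + ((conj u - u) * (h x v / h v v)) • v := rfl

/-- The vectors `v₁`, `v₂` span a nondegenerate plane, `⟨v₁, v₂⟩ = r > 0`, `⟨vᵢ, vᵢ⟩ = nᵢ ≠ 0`, and
`u₁`, `u₂` are points of the open upper half of the unit circle. -/
structure NormalPair (h : V →ₗ[ℂ] V →ₗ⋆[ℂ] ℂ) (v₁ v₂ : V) (u₁ u₂ : ℂ) (n₁ n₂ r : ℝ) : Prop where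
  self₁ : h v₁ v₁ = n₁
  self₂ : h v₂ v₂ = n₂
  cross : h v₁ v₂ = r
  cross' : h v₂ v₁ = r
  ne₁ : n₁ ≠ 0
  ne₂ : n₂ ≠ 0
  pos : 0 < r
  disc : n₁ * n₂ - r ^ 2 ≠ 0
  unit₁ : u₁.re ^ 2 + u₁.im ^ 2 = 1
  unit₂ : u₂.re ^ 2 + u₂.im ^ 2 = 1
  im₁ : 0 < u₁.im
  im₂ : 0 < u₂.im

/-- Half of the trace of the product of the rotations on the plane of their centres. -/
def halfTrace (u₁ u₂ : ℂ) (n₁ n₂ r : ℝ) : ℝ :=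
  u₁.re * u₂.re + u₁.im * u₂.im - 2 * u₁.im * u₂.im * (r / n₁ * (r / n₂))

/-- The selfadjoint traceless part of a product `S` of rotations. -/
def skewPart (S : Module.End ℂ V) (τ : ℝ) : Module.End ℂ V :=
  (-Complex.I) • (S - (τ : ℂ) • (1 : Module.End ℂ V))

theorem skewPart_apply (S : Module.End ℂ V) (τ : ℝ) (x : V) :
    skewPart S τ x = (-Complex.I) • (S x - (τ : ℂ) • x) := rfl

namespace NormalPair

variable {h : V →ₗ[ℂ] V →ₗ⋆[ℂ] ℂ} {v₁ v₂ : V} {u₁ u₂ : ℂ} {n₁ n₂ r : ℝ}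

theorem rotation_mul_apply₁ (P : NormalPair h v₁ v₂ u₁ u₂ n₁ n₂ r) :
    (rotation h u₂ v₂ * rotation h u₁ v₁) v₁ =
      (conj u₁ * u₂) • v₁ + (conj u₁ * (conj u₂ - u₂) * (r / n₂ : ℝ)) • v₂ := by
  have hn₁ : (n₁ : ℂ) ≠ 0 := by exact_mod_cast P.ne₁
  rw [Module.End.mul_apply, rotation_apply h u₁, P.self₁, div_self hn₁, mul_one, ← add_smul,
    add_sub_cancel, map_smul, rotation_apply, P.cross, P.self₂]
  push_cast
  module

theorem rotation_mul_apply₂ (P : NormalPair h v₁ v₂ u₁ u₂ n₁ n₂ r) :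
    (rotation h u₂ v₂ * rotation h u₁ v₁) v₂ =
      ((conj u₁ - u₁) * u₂ * (r / n₁ : ℝ)) • v₁ +
        (u₁ * conj u₂ + (conj u₁ - u₁) * (conj u₂ - u₂) * (r / n₁ : ℝ) * (r / n₂ : ℝ)) • v₂ := by
  have hn₁ : (n₁ : ℂ) ≠ 0 := by exact_mod_cast P.ne₁
  have hn₂ : (n₂ : ℂ) ≠ 0 := by exact_mod_cast P.ne₂
  rw [Module.End.mul_apply, rotation_apply h u₁, map_add, map_smul, map_smul, rotation_apply,
    rotation_apply, P.cross, P.self₂, P.cross', P.self₁, div_self hn₂]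
  push_cast
  match_scalars 
  · field_simp
    ring
  · field_simp

/-- The matrix of `A` in the basis `v₁, v₂`, on which all later computations rest. The diagonal
coefficients here and in `skewPart_apply₂` are opposite, since `A` is traceless on the plane. -/
theorem skewPart_apply₁ (P : NormalPair h v₁ v₂ u₁ u₂ n₁ n₂ r) :
    skewPart (rotation h u₂ v₂ * rotation h u₁ v₁) (halfTrace u₁ u₂ n₁ n₂ r) v₁ =
      (((u₁.re * u₂.im - u₁.im * u₂.re : ℝ) : ℂ) -
        2 * Complex.I * u₁.im * u₂.im * (r / n₁ : ℝ) * (r / n₂ : ℝ)) • v₁ +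
          (-2 * conj u₁ * u₂.im * (r / n₂ : ℝ)) • v₂ := by
  rw [skewPart_apply, P.rotation_mul_apply₁, halfTrace]
  generalize r / n₁ = k₁
  generalize r / n₂ = k₂
  match_scalars <;> apply Complex.ext <;> simp <;> ring

theorem skewPart_apply₂ (P : NormalPair h v₁ v₂ u₁ u₂ n₁ n₂ r) :
    skewPart (rotation h u₂ v₂ * rotation h u₁ v₁) (halfTrace u₁ u₂ n₁ n₂ r) v₂ =
      (-2 * u₂ * u₁.im * (r / n₁ : ℝ)) • v₁ +
        (-((u₁.re * u₂.im - u₁.im * u₂.re : ℝ) : ℂ) +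
          2 * Complex.I * u₁.im * u₂.im * (r / n₁ : ℝ) * (r / n₂ : ℝ)) • v₂ := by
  rw [skewPart_apply, P.rotation_mul_apply₂, halfTrace]
  generalize r / n₁ = k₁
  generalize r / n₂ = k₂
  match_scalars <;> apply Complex.ext <;> simp <;> ring

end NormalPair

/-! ### Selfadjoint operators with scalar square -/

/-- On the plane `c^⊥`, the operator `A` is selfadjoint and `A ^ 2 = κ`. -/
structure IsAdapted (h : V →ₗ[ℂ] V →ₗ⋆[ℂ] ℂ) (c : V) (A : Module.End ℂ V) (κ : ℝ) : Prop where
  perp : ∀ x, h x c = 0 → h (A x) c = 0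
  adj : ∀ x y, h x c = 0 → h y c = 0 → h (A x) y = h x (A y)
  sq : ∀ x, h x c = 0 → A (A x) = (κ : ℂ) • x

namespace NormalPair

variable {h : V →ₗ[ℂ] V →ₗ⋆[ℂ] ℂ} {v₁ v₂ : V} {u₁ u₂ : ℂ} {n₁ n₂ r : ℝ}

/-- Cayley–Hamilton on the plane: `S² - 2τS + 1 = 0` is equivalent to `(-i(S - τ))² = 1 - τ²`. -/
theorem skewPart_sq₁ (P : NormalPair h v₁ v₂ u₁ u₂ n₁ n₂ r) {A : Module.End ℂ V}
    (hA : A = skewPart (rotation h u₂ v₂ * rotation h u₁ v₁) (halfTrace u₁ u₂ n₁ n₂ r)) :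
    A (A v₁) = ((1 - halfTrace u₁ u₂ n₁ n₂ r ^ 2 : ℝ) : ℂ) • v₁ := by
  have e₁ : A v₁ = _ := hA ▸ P.skewPart_apply₁
  have e₂ : A v₂ = _ := hA ▸ P.skewPart_apply₂
  rw [e₁, map_add, map_smul, map_smul, e₁, e₂, halfTrace]
  generalize r / n₁ = k₁
  generalize r / n₂ = k₂
  match_scalars
  · apply Complex.ext
    · simp [sq]
      linear_combination (u₂.re ^ 2 + u₂.im ^ 2) * P.unit₁ + P.unit₂
    · simp [sq]
      ring
  · ring

theorem skewPart_sq₂ (P : NormalPair h v₁ v₂ u₁ u₂ n₁ n₂ r) {A : Module.End ℂ V}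
    (hA : A = skewPart (rotation h u₂ v₂ * rotation h u₁ v₁) (halfTrace u₁ u₂ n₁ n₂ r)) :
    A (A v₂) = ((1 - halfTrace u₁ u₂ n₁ n₂ r ^ 2 : ℝ) : ℂ) • v₂ := by
  have e₁ : A v₁ = _ := hA ▸ P.skewPart_apply₁
  have e₂ : A v₂ = _ := hA ▸ P.skewPart_apply₂
  rw [e₂, map_add, map_smul, map_smul, e₁, e₂, halfTrace]
  generalize r / n₁ = k₁
  generalize r / n₂ = k₂
  match_scalars
  · ring
  · apply Complex.ext
    · simp [sq]
      linear_combination (u₂.re ^ 2 + u₂.im ^ 2) * P.unit₁ + P.unit₂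
    · simp [sq]
      ring

/-- On the plane `S + S⁻¹ = 2τ`, so `S - τ = (S - S⁻¹)/2` is skew-adjoint for the isometry `S`, and
the factor `-i` makes it selfadjoint. The proof verifies this on the basis `v₁, v₂`. -/
theorem skewPart_adj (P : NormalPair h v₁ v₂ u₁ u₂ n₁ n₂ r) {A : Module.End ℂ V}
    (hA : A = skewPart (rotation h u₂ v₂ * rotation h u₁ v₁) (halfTrace u₁ u₂ n₁ n₂ r))
    (a b a' b' : ℂ) :
    h (A (a • v₁ + b • v₂)) (a' • v₁ + b' • v₂) = h (a • v₁ + b • v₂) (A (a' • v₁ + b' • v₂)) := by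
  have e₁ : A v₁ = _ := hA ▸ P.skewPart_apply₁
  have e₂ : A v₂ = _ := hA ▸ P.skewPart_apply₂
  obtain ⟨k₁, hk₁⟩ : ∃ k, k = r / n₁ := ⟨_, rfl⟩
  obtain ⟨k₂, hk₂⟩ : ∃ k, k = r / n₂ := ⟨_, rfl⟩
  rw [← hk₂] at e₁
  rw [← hk₁] at e₂
  rw [← hk₁] at e₁
  rw [← hk₂] at e₂
  have i₁ : k₁ * n₁ = r := by rw [hk₁, div_mul_cancel₀ _ P.ne₁]
  have i₂ : k₂ * n₂ = r := by rw [hk₂, div_mul_cancel₀ _ P.ne₂]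
  have h11 : h (A v₁) v₁ = h v₁ (A v₁) := by
    rw [e₁]
    simp only [map_add, map_smul, LinearMap.add_apply, LinearMap.smul_apply, LinearMap.map_smulₛₗ,
      smul_eq_mul, P.self₁, P.cross, P.cross']
    apply Complex.ext <;> simp
    linear_combination (-4) * u₁.im * u₂.im * k₂ * i₁
  have h22 : h (A v₂) v₂ = h v₂ (A v₂) := by
    rw [e₂]
    simp only [map_add, map_smul, LinearMap.add_apply, LinearMap.smul_apply, LinearMap.map_smulₛₗ,
      smul_eq_mul, P.self₂, P.cross, P.cross']
    apply Complex.ext <;> simp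
    linear_combination 4 * u₁.im * u₂.im * k₁ * i₂
  have h12 : h (A v₁) v₂ = h v₁ (A v₂) := by
    rw [e₁, e₂]
    simp only [map_add, map_smul, LinearMap.add_apply, LinearMap.smul_apply, LinearMap.map_smulₛₗ,
      smul_eq_mul, P.self₁, P.self₂, P.cross]
    apply Complex.ext <;> simp
    · linear_combination (-2) * u₁.re * u₂.im * i₂ + 2 * u₂.re * u₁.im * i₁
    · linear_combination 2 * u₁.im * u₂.im * i₂ - 2 * u₂.im * u₁.im * i₁
  have h21 : h (A v₂) v₁ = h v₂ (A v₁) := by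
    rw [e₁, e₂]
    simp only [map_add, map_smul, LinearMap.add_apply, LinearMap.smul_apply, LinearMap.map_smulₛₗ,
      smul_eq_mul, P.self₁, P.self₂, P.cross']
    apply Complex.ext <;> simp
    · linear_combination 2 * u₁.re * u₂.im * i₂ - 2 * u₂.re * u₁.im * i₁
    · linear_combination 2 * u₁.im * u₂.im * i₂ - 2 * u₂.im * u₁.im * i₁
  simp only [map_add, map_smul, LinearMap.add_apply, LinearMap.smul_apply, LinearMap.map_smulₛₗ,
    smul_eq_mul, h11, h12, h21, h22]

theorem isAdapted (P : NormalPair h v₁ v₂ u₁ u₂ n₁ n₂ r) {c : V} (h₁ : h v₁ c = 0) (h₂ : h v₂ c = 0)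
    (hspan : ∀ x, h x c = 0 → ∃ a b : ℂ, x = a • v₁ + b • v₂) :
    IsAdapted h c (skewPart (rotation h u₂ v₂ * rotation h u₁ v₁) (halfTrace u₁ u₂ n₁ n₂ r))
      (1 - halfTrace u₁ u₂ n₁ n₂ r ^ 2) where
  perp x hx := by
    obtain ⟨a, b, rfl⟩ := hspan x hx
    rw [map_add, map_smul, map_smul, P.skewPart_apply₁, P.skewPart_apply₂]
    simp only [map_add, map_smul, LinearMap.add_apply, LinearMap.smul_apply, h₁, h₂, smul_zero,
      add_zero]
  adj x y hx hy := by
    obtain ⟨a, b, rfl⟩ := hspan x hx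
    obtain ⟨a', b', rfl⟩ := hspan y hy
    exact P.skewPart_adj rfl a b a' b'
  sq x hx := by
    obtain ⟨a, b, rfl⟩ := hspan x hx
    rw [map_add, map_smul, map_smul, map_add, map_smul, map_smul, P.skewPart_sq₁ rfl,
      P.skewPart_sq₂ rfl, smul_add, smul_comm a, smul_comm b]

theorem eq_zero_of_orthogonal (P : NormalPair h v₁ v₂ u₁ u₂ n₁ n₂ r) {a b : ℂ}
    (h₁ : h (a • v₁ + b • v₂) v₁ = 0) (h₂ : h (a • v₁ + b • v₂) v₂ = 0) : a = 0 ∧ b = 0 := by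
  simp only [map_add, map_smul, LinearMap.add_apply, LinearMap.smul_apply, smul_eq_mul,
    P.self₁, P.self₂, P.cross, P.cross'] at h₁ h₂
  have hD : (n₁ * n₂ - r ^ 2 : ℂ) ≠ 0 := by exact_mod_cast P.disc
  constructor
  · refine (mul_eq_zero.1 (?_ : a * (n₁ * n₂ - r ^ 2 : ℂ) = 0)).resolve_right hD
    linear_combination h₁ * n₂ - h₂ * r
  · refine (mul_eq_zero.1 (?_ : b * (n₁ * n₂ - r ^ 2 : ℂ) = 0)).resolve_right hD
    linear_combination h₂ * n₁ - h₁ * r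

theorem linearIndep (P : NormalPair h v₁ v₂ u₁ u₂ n₁ n₂ r) {a b : ℂ} (e : a • v₁ + b • v₂ = 0) :
    a = 0 ∧ b = 0 :=
  P.eq_zero_of_orthogonal (by rw [e]; simp) (by rw [e]; simp)

theorem unit_ne_zero₁ (P : NormalPair h v₁ v₂ u₁ u₂ n₁ n₂ r) : u₁ ≠ 0 := fun h0 => by
  simpa [h0] using P.im₁

theorem unit_ne_zero₂ (P : NormalPair h v₁ v₂ u₁ u₂ n₁ n₂ r) : u₂ ≠ 0 := fun h0 => by
  simpa [h0] using P.im₂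

theorem mul_conj₁ (P : NormalPair h v₁ v₂ u₁ u₂ n₁ n₂ r) : u₁ * conj u₁ = 1 := by
  rw [Complex.mul_conj, Complex.normSq_apply]
  exact_mod_cast (by linear_combination P.unit₁ : u₁.re * u₁.re + u₁.im * u₁.im = 1)

theorem mul_conj₂ (P : NormalPair h v₁ v₂ u₁ u₂ n₁ n₂ r) : u₂ * conj u₂ = 1 := by
  rw [Complex.mul_conj, Complex.normSq_apply]
  exact_mod_cast (by linear_combination P.unit₂ : u₂.re * u₂.re + u₂.im * u₂.im = 1)

/-- This is the coefficient of `v₂` in `A v₁`; its nonvanishing makes `v₁, A v₁` a basis of the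
plane and keeps `v₁` from being fixed. -/
theorem coeff_ne_zero₁ (P : NormalPair h v₁ v₂ u₁ u₂ n₁ n₂ r) :
    -2 * conj u₁ * u₂.im * (r / n₂ : ℝ) ≠ 0 := by
  have h1 : conj u₁ ≠ 0 := by simpa using P.unit_ne_zero₁
  have h2 : (u₂.im : ℂ) ≠ 0 := by exact_mod_cast P.im₂.ne'
  have h3 : ((r / n₂ : ℝ) : ℂ) ≠ 0 := by exact_mod_cast div_ne_zero P.pos.ne' P.ne₂
  exact mul_ne_zero (mul_ne_zero (mul_ne_zero (by norm_num) h1) h2) h3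

theorem coeff_ne_zero₂ (P : NormalPair h v₁ v₂ u₁ u₂ n₁ n₂ r) :
    -2 * u₂ * u₁.im * (r / n₁ : ℝ) ≠ 0 := by
  have h2 : (u₁.im : ℂ) ≠ 0 := by exact_mod_cast P.im₁.ne'
  have h3 : ((r / n₁ : ℝ) : ℂ) ≠ 0 := by exact_mod_cast div_ne_zero P.pos.ne' P.ne₁
  exact mul_ne_zero (mul_ne_zero (mul_ne_zero (by norm_num) P.unit_ne_zero₂) h2) h3

/-- The centres are not fixed by the product of the rotations. -/
theorem skewPart_ne_smul₁ (P : NormalPair h v₁ v₂ u₁ u₂ n₁ n₂ r) (μ : ℂ) :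
    skewPart (rotation h u₂ v₂ * rotation h u₁ v₁) (halfTrace u₁ u₂ n₁ n₂ r) v₁ ≠ μ • v₁ := by
  intro e
  rw [P.skewPart_apply₁, ← sub_eq_zero, add_sub_right_comm, ← sub_smul] at e
  exact P.coeff_ne_zero₁ (P.linearIndep e).2

theorem skewPart_ne_smul₂ (P : NormalPair h v₁ v₂ u₁ u₂ n₁ n₂ r) (μ : ℂ) :
    skewPart (rotation h u₂ v₂ * rotation h u₁ v₁) (halfTrace u₁ u₂ n₁ n₂ r) v₂ ≠ μ • v₂ := by
  intro e
  rw [P.skewPart_apply₂, ← sub_eq_zero, add_sub_assoc, ← sub_smul] at e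
  exact P.coeff_ne_zero₂ (P.linearIndep e).1

end NormalPair

theorem skewPart_skewPart (S : Module.End ℂ V) (τ : ℝ) (x : V) :
    skewPart S τ (skewPart S τ x) = -S (S x) + (2 * τ : ℂ) • S x - (τ ^ 2 : ℂ) • x := by
  simp only [skewPart_apply, map_smul, map_sub, smul_sub, smul_smul]
  match_scalars
  · linear_combination Complex.I_sq
  · linear_combination (-2 * τ : ℂ) * Complex.I_sq
  · linear_combination (τ ^ 2 : ℂ) * Complex.I_sq

/-- The Cayley–Hamilton identity determines the half-trace. -/
theorem halfTrace_unique {S : Module.End ℂ V} {v : V} {τ τ' : ℝ} (hv : S v ≠ 0)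
    (h₁ : skewPart S τ (skewPart S τ v) = ((1 - τ ^ 2 : ℝ) : ℂ) • v)
    (h₂ : skewPart S τ' (skewPart S τ' v) = ((1 - τ' ^ 2 : ℝ) : ℂ) • v) : τ = τ' := by
  rw [skewPart_skewPart] at h₁ h₂
  have : (2 * (τ - τ') : ℂ) • S v = 0 := by
    have e := congrArg₂ (· - ·) h₁ h₂
    push_cast at e
    rw [← sub_eq_zero] at e
    refine Eq.trans ?_ e
    module
  have := (smul_eq_zero.1 this).resolve_right hv
  have : (τ : ℂ) - τ' = 0 := by simpa using this
  exact_mod_cast sub_eq_zero.1 this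

/-! ### Isometries commuting with the product -/

/-- In the algebra `ℂ[A]` with `A ^ 2 = κ`, an element `z + w A` can be carried to an element `x + y A`
of `ℝ[A]` of positive norm by an element `b₀ + b₁ A` of the unitary group. -/
theorem exists_unitary_coeffs (κ : ℝ) (z w : ℂ) (hΔ : z ^ 2 - κ * w ^ 2 ≠ 0)
    (hs : (z * conj w).re = 0 → 0 < Complex.normSq z + κ * Complex.normSq w) :
    ∃ (x y : ℝ) (b₀ b₁ : ℂ), Complex.normSq b₀ + κ * Complex.normSq b₁ = 1 ∧
      (b₀ * conj b₁).re = 0 ∧ b₀ * z + κ * b₁ * w = x ∧ b₀ * w + b₁ * z = y ∧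
      0 < x ^ 2 - κ * y ^ 2 := by
  -- With `a = z + wA` and `a* = conj z + conj w A`, one has `aa* = m + nA`, the norm of `a` is `Δ`,
  -- and taking norms in `aa*` yields `|Δ|² = m² - κn²`.
  set Δ := z ^ 2 - κ * w ^ 2 with hΔ'
  set m := Complex.normSq z + κ * Complex.normSq w with hm
  set n := 2 * (z * conj w).re with hn
  set D := ‖Δ‖ with hD
  have hD0 : 0 < D := norm_pos_iff.2 hΔ
  have hD2 : D ^ 2 = m ^ 2 - κ * n ^ 2 := by
    rw [hD, ← Complex.normSq_eq_norm_sq, hm, hn, hΔ']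
    simp [Complex.normSq_apply, sq]
    ring
  -- Failure forces `m < 0`, `κ < 0` and `n = 0`, which is the case excluded by `hs`.
  have hX : 0 < m + D := by
    by_contra! hneg
    have hm0 : m < 0 := by linarith
    have hmD : D ^ 2 ≤ m ^ 2 := by nlinarith
    have hκ : κ < 0 := by
      by_contra! hκ
      have : 0 ≤ m := add_nonneg (Complex.normSq_nonneg _) (mul_nonneg hκ (Complex.normSq_nonneg _))
      linarith
    have hn0 : n ^ 2 ≤ 0 := by nlinarith
    have hn1 : n = 0 := by nlinarith
    have := hs (by linarith)
    linarith
  set X := m + D with hXdef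
  obtain ⟨l, hl0, hl⟩ : ∃ l : ℝ, 0 < l ∧ l ^ 2 * (2 * X) = 1 := by
    refine ⟨(Real.sqrt (2 * X))⁻¹, by positivity, ?_⟩
    rw [inv_pow, Real.sq_sqrt (by positivity)]
    field_simp
  -- Equivalently `(X + nA)² = 2X(m + nA)`, so `l(X + nA)` is a square root of `aa*`.
  have hX2 : X ^ 2 + κ * n ^ 2 = 2 * m * X := by rw [hXdef]; linear_combination hD2
  set g : ℂ := l / Δ with hg
  have hgn : Complex.normSq g * D ^ 2 = l ^ 2 := by
    rw [hg, Complex.normSq_div, hD, ← Complex.normSq_eq_norm_sq, Complex.normSq_ofReal]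
    have : Complex.normSq Δ ≠ 0 := by simpa using hΔ
    field_simp
  have hgΔ : g * Δ = l := div_mul_cancel₀ _ hΔ
  -- Polar decomposition: the unitary element is `l(X + nA)a⁻¹`, where `a⁻¹ = (z - wA)/Δ`, and it
  -- carries `a` to `l(X + nA)`.
  refine ⟨l * X, l * n, g * (X * z - κ * n * w), g * (n * z - X * w), ?_, ?_, ?_, ?_, ?_⟩
  · have e : Complex.normSq (X * z - κ * n * w) + κ * Complex.normSq (n * z - X * w) =
        2 * X * D ^ 2 := by
      have : Complex.normSq (X * z - κ * n * w) + κ * Complex.normSq (n * z - X * w) =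
          (X ^ 2 + κ * n ^ 2) * m - 2 * X * κ * n ^ 2 := by
        simp only [hm, Complex.normSq_apply, Complex.sub_re, Complex.sub_im, Complex.mul_re,
          Complex.mul_im, Complex.ofReal_re, Complex.ofReal_im]
        have : n = 2 * (z.re * w.re + z.im * w.im) := by simp [hn]
        linear_combination (2 * κ * X * n) * this
      rw [this, hX2, hD2]; ring
    rw [Complex.normSq_mul, Complex.normSq_mul]
    linear_combination Complex.normSq g * e + 2 * X * hgn + hl
  · have e : ((X * z - κ * n * w) * conj (n * z - X * w)).re = 0 := by
      have : ((X * z - κ * n * w) * conj (n * z - X * w)).re =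
          X * n * m - (X ^ 2 + κ * n ^ 2) * (n / 2) := by
        simp only [hm, Complex.normSq_apply, Complex.sub_re, Complex.sub_im, Complex.mul_re,
          Complex.mul_im, Complex.ofReal_re, Complex.ofReal_im, Complex.conj_re, Complex.conj_im]
        have : n = 2 * (z.re * w.re + z.im * w.im) := by simp [hn]
        linear_combination (X ^ 2 + κ * n ^ 2) / 2 * this
      rw [this, hX2]; ring
    rw [map_mul, mul_mul_mul_comm, Complex.mul_conj, Complex.re_ofReal_mul, e, mul_zero]
  · push_cast
    linear_combination X * hgΔ
  · push_cast
    linear_combination n * hgΔ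
  · have : (l * X) ^ 2 - κ * (l * n) ^ 2 = l ^ 2 * (2 * D * X) := by
      rw [hXdef]; linear_combination - l ^ 2 * hD2
    rw [this]; positivity

/-- The operator `b₀ + b₁ A` on `c^⊥`, extended by `c ↦ c`, is a linear isometry. -/
theorem IsAdapted.exists_isometry {h : V →ₗ[ℂ] V →ₗ⋆[ℂ] ℂ} (hh : HasSignatureTwoOne h) {c : V}
    {A : Module.End ℂ V} {κ : ℝ} (hA : IsAdapted h c A κ) (hc : h c c ≠ 0) {b₀ b₁ : ℂ}
    (hb : Complex.normSq b₀ + κ * Complex.normSq b₁ = 1) (hb' : (b₀ * conj b₁).re = 0) {γ : ℂ}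
    (hγ : A c = γ • c) :
    ∃ C : V →ₗ[ℂ] V, (∀ x y, h (C x) (C y) = h x y) ∧ (∀ x, C (A x) = A (C x)) ∧
      ∀ x, h x c = 0 → C x = b₀ • x + b₁ • A x := by
  -- The orthogonal projection to `c^⊥`; `C` acts as `B = b₀ + b₁A` on its image and as the identity
  -- on `ℂc`.
  let π : V →ₗ[ℂ] V :=
    { toFun := fun x => x - (h x c / h c c) • c
      map_add' := fun x y => by
        simp only [map_add, LinearMap.add_apply, add_div, add_smul]; abel
      map_smul' := fun a x => by
        simp only [map_smul, LinearMap.smul_apply, smul_eq_mul, mul_div_assoc, smul_sub, mul_smul,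
          RingHom.id_apply] }
  have hπ : ∀ x, π x = x - (h x c / h c c) • c := fun _ => rfl
  have hπc : ∀ x, h (π x) c = 0 := fun x => by
    rw [hπ, map_sub, map_smul, LinearMap.sub_apply, LinearMap.smul_apply, smul_eq_mul,
      div_mul_cancel₀ _ hc, sub_self]
  let B : V →ₗ[ℂ] V := b₀ • LinearMap.id + b₁ • A
  have hB : ∀ x, B x = b₀ • x + b₁ • A x := fun _ => rfl
  let C : V →ₗ[ℂ] V := B ∘ₗ π + (LinearMap.id - π)
  have hC : ∀ x, C x = B (π x) + (x - π x) := fun _ => rfl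
  have hBc : ∀ x, h x c = 0 → h (B x) c = 0 := fun x hx => by
    simp [hB, hx, hA.perp x hx]
  have hperp : ∀ x, h x c = 0 → C x = B x := fun x hx => by
    have : π x = x := by rw [hπ, hx]; simp
    rw [hC, this, sub_self, add_zero]
  have hcc : C c = c := by
    have : π c = 0 := by rw [hπ, div_self hc]; simp
    rw [hC, this, map_zero, zero_add, sub_zero]
  have hdec : ∀ x, ∃ (p : V) (a : ℂ), h p c = 0 ∧ x = p + a • c := fun x =>
    ⟨π x, h x c / h c c, hπc x, by rw [hπ]; abel⟩
  have hsymm : ∀ x, h x c = 0 → h c x = 0 := fun x hx => by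
    rw [← hh.conj_symm, hx, map_zero]
  have hBB : ∀ x y, h x c = 0 → h y c = 0 → h (B x) (B y) = h x y := by
    intro x y hx hy
    have e : h (A x) (A y) = κ * h x y := by
      rw [← hA.adj (A x) y (hA.perp x hx) hy, hA.sq x hx, map_smul, LinearMap.smul_apply,
        smul_eq_mul]
    simp only [hB, map_add, map_smul, LinearMap.add_apply, LinearMap.smul_apply,
      LinearMap.map_smulₛₗ, smul_eq_mul, e, hA.adj x y hx hy]
    -- Together with `f₂` this is `(b₀ + b₁A)(conj b₀ + conj b₁A) = 1`, separated into its constant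
    -- and `A`-coefficients.
    have f₁ : b₀ * conj b₀ + κ * (b₁ * conj b₁) = 1 := by
      rw [Complex.mul_conj, Complex.mul_conj]; exact_mod_cast hb
    have f₂ : b₀ * conj b₁ + b₁ * conj b₀ = 0 := by
      have := Complex.add_conj (b₀ * conj b₁)
      rw [hb'] at this
      simpa [mul_comm] using this
    linear_combination h x y * f₁ + h x (A y) * f₂
  refine ⟨C, fun x y => ?_, fun x => ?_, fun x hx => hperp x hx⟩
  · obtain ⟨p, a, hp, rfl⟩ := hdec x
    obtain ⟨q, b, hq, rfl⟩ := hdec y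
    have hC' : ∀ (p : V) (a : ℂ), h p c = 0 → C (p + a • c) = B p + a • c := fun p a hp => by
      rw [map_add, map_smul, hperp p hp, hcc]
    rw [hC' p a hp, hC' q b hq]
    simp only [map_add, map_smul, LinearMap.add_apply, LinearMap.smul_apply,
      LinearMap.map_smulₛₗ, smul_eq_mul, hBB p q hp hq, hBc p hp, hp, hsymm _ hq,
      hsymm _ (hBc q hq)]
  · obtain ⟨p, a, hp, rfl⟩ := hdec x
    rw [map_add, map_smul, hγ, map_add, map_add, map_smul, map_smul, map_smul, hcc,
      hperp _ (hA.perp p hp), hperp p hp, hB, hB, map_add, map_add, map_smul, map_smul, map_smul,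
      hγ]

/-! ### Segments without fixed points -/

/-- Multiplying an eigenvector `(x + yA)v` by `x - yA` gives a nonzero multiple of `v` when the norm
is nonzero, so `v` would be an eigenvector as well. -/
theorem IsAdapted.ne_smul_of_norm_ne_zero {h : V →ₗ[ℂ] V →ₗ⋆[ℂ] ℂ} {c : V}
    {A : Module.End ℂ V} {κ : ℝ} (hA : IsAdapted h c A κ) {v : V} (hv : h v c = 0)
    (hne : ∀ μ : ℂ, A v ≠ μ • v) {x y : ℝ} (hN : x ^ 2 - κ * y ^ 2 ≠ 0) (μ : ℂ) :
    A ((x : ℂ) • v + (y : ℂ) • A v) ≠ μ • ((x : ℂ) • v + (y : ℂ) • A v) := by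
  intro e
  set u := (x : ℂ) • v + (y : ℂ) • A v with hu
  have hN' : (x ^ 2 - κ * y ^ 2 : ℂ) ≠ 0 := by exact_mod_cast hN
  have e1 : ((x : ℂ) - y * μ) • u = (x ^ 2 - κ * y ^ 2 : ℂ) • v := by
    rw [sub_smul, mul_smul, ← e, hu, map_add, map_smul, map_smul, hA.sq v hv]
    module
  have e2 := congrArg A e1
  rw [map_smul, map_smul, e, smul_comm, e1, smul_comm] at e2
  exact hne μ (smul_right_injective V hN' e2).symm

/-- With representatives scaled as in the definition of the segment, its points are `(a + bt(x +
yA))v` with `a, b ≥ 0` and `t` real, `tx > 0`. Their norm `a² + 2abtx + b²t²(x² - κy²)` is positive,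
so none of them is fixed. The sign condition on `e` makes the choice of arc agree with the sign of
`x`. -/
theorem IsAdapted.segment {h : V →ₗ[ℂ] V →ₗ⋆[ℂ] ℂ} (hh : HasSignatureTwoOne h) {c : V}
    {A : Module.End ℂ V} {κ : ℝ} (hA : IsAdapted h c A κ) {v : V} (hv : h v c = 0) (hv0 : v ≠ 0)
    (hne : ∀ μ : ℂ, A v ≠ μ • v) {x y : ℝ} (hN : 0 < x ^ 2 - κ * y ^ 2) {e : V} (he0 : e ≠ 0)
    {ρ : ℂ} (he : e = ρ • ((x : ℂ) • v + (y : ℂ) • A v))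
    (hs : 0 < (h e e).re * (h v v).re) :
    h v e ≠ 0 ∧ ∀ p ∈ geodesicSegment h (Projectivization.mk ℂ v hv0) (Projectivization.mk ℂ e he0),
      ¬ IsFixedPoint A p := by
  obtain ⟨n, hn⟩ : ∃ n : ℝ, h v v = n := ⟨_, (hh.self_real v).symm⟩
  have hAv := hA.adj v v hv hv
  obtain ⟨H, hH⟩ : ∃ H : ℝ, h v (A v) = H := by
    refine ⟨_, (Complex.conj_eq_iff_re.1 ?_).symm⟩
    rw [hh.conj_symm, hAv]
  rw [hH] at hAv
  set u := (x : ℂ) • v + (y : ℂ) • A v with hu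
  have hvu : h v u = (x * n + y * H : ℝ) := by
    rw [hu, map_add, LinearMap.map_smulₛₗ, LinearMap.map_smulₛₗ, hn, hH]
    simp
  have hAA : h (A v) (A v) = κ * n := by
    rw [← hA.adj (A v) v (hA.perp v hv) hv, hA.sq v hv, map_smul, LinearMap.smul_apply,
      smul_eq_mul, hn]
  have huu : h u u = ((x ^ 2 + κ * y ^ 2) * n + 2 * x * y * H : ℝ) := by
    rw [hu]
    simp only [map_add, map_smul, LinearMap.add_apply, LinearMap.smul_apply,
      LinearMap.map_smulₛₗ, smul_eq_mul, hn, hH, hAv, hAA, Complex.conj_ofReal]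
    push_cast
    ring
  have hρ0 : ρ ≠ 0 := fun h0 => he0 (by rw [he, h0, zero_smul])
  have hs' : 0 < ((x ^ 2 + κ * y ^ 2) * n + 2 * x * y * H) * n := by
    rw [he, apply_smul_smul, Complex.mul_conj, Complex.re_ofReal_mul, huu, Complex.ofReal_re, hn,
      Complex.ofReal_re, mul_assoc] at hs
    exact (pos_iff_pos_of_mul_pos hs).1 (Complex.normSq_pos.2 hρ0)
  have hn0 : 0 < n ^ 2 := by
    have : n ≠ 0 := fun h0 => by simp [h0] at hs'
    positivity
  -- Adding the positive `(x² - κy²)n²` to `hs'` cancels `κ` and gives twice the left side: `x`, up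
  -- to the sign of `n`, has the sign of `⟨v, u⟩`.
  have hkey : 0 < x * (n * (x * n + y * H)) := by nlinarith [mul_pos hN hn0]
  have hP0 : x * n + y * H ≠ 0 := fun h0 => by simp [h0] at hkey
  refine ⟨?_, ?_⟩
  · rw [he, LinearMap.map_smulₛₗ, hvu, smul_eq_mul]
    exact mul_ne_zero (by simpa using hρ0) (by exact_mod_cast hP0)
  · rintro p ⟨v', w', hv', hw', ev, ew, him, hpos, a, b, ha, hb, hab, rfl⟩
    obtain ⟨l, hl0, rfl⟩ := exists_smul_of_mk_eq ev
    obtain ⟨k, hk0, rfl⟩ := exists_smul_of_mk_eq ew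
    rw [isFixedPoint_mk]
    rintro ⟨μ, hμ⟩
    have hl1 : 0 < Complex.normSq l := Complex.normSq_pos.2 hl0
    rw [he, smul_smul, apply_smul_smul, hvu] at him hpos
    rw [apply_smul_smul, Complex.mul_conj, hn] at hpos
    set f := l * conj (k * ρ) with hf
    have hfim : f.im = 0 := by
      rw [Complex.im_mul_ofReal] at him
      exact (mul_eq_zero.1 him).resolve_right hP0
    obtain ⟨g, hg⟩ : ∃ g : ℝ, f = g := ⟨f.re, by apply Complex.ext <;> simp [hfim]⟩
    rw [hg, ← Complex.ofReal_mul, ← Complex.ofReal_mul, Complex.ofReal_re, Complex.ofReal_re] at hpos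
    have hgx : 0 < g * x := by
      have h1 : 0 < g * (n * (x * n + y * H)) := by
        have : g * (x * n + y * H) * (Complex.normSq l * n) =
          Complex.normSq l * (g * (n * (x * n + y * H))) := by ring
        rw [this] at hpos
        exact (pos_iff_pos_of_mul_pos hpos).1 hl1
      have h2 := mul_pos h1 hkey
      have : g * (n * (x * n + y * H)) * (x * (n * (x * n + y * H))) =
        (n * (x * n + y * H)) ^ 2 * (g * x) := by ring
      rw [this] at h2
      exact (pos_iff_pos_of_mul_pos h2).1 (by
        have : n * (x * n + y * H) ≠ 0 := fun h0 => by simp [h0] at hkey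
        positivity)
    -- Since `l conj(kρ)` is the real number `g`, the scalars `kρ` and `l` differ by the real factor
    -- `g'`; the segment thus lies in `l ℝ[A]v`.
    set g' := g / Complex.normSq l with hg'
    have hkl : k * ρ = g' * l := by
      have h1 : conj f = g := by rw [hg, Complex.conj_ofReal]
      rw [hf, map_mul, Complex.conj_conj] at h1
      have h2 : l * conj l = Complex.normSq l := Complex.mul_conj l
      have h3 : (Complex.normSq l : ℂ) ≠ 0 := by exact_mod_cast hl1.ne'
      rw [hg']
      push_cast
      field_simp
      linear_combination l * h1 - k * ρ * h2
    have hg'x : 0 < g' * x := by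
      rw [hg', div_mul_eq_mul_div]; positivity
    have hpt : (a : ℂ) • l • v + (b : ℂ) • k • e =
        l • (((a + b * g' * x : ℝ) : ℂ) • v + ((b * g' * y : ℝ) : ℂ) • A v) := by
      rw [he, smul_smul k, hkl, hu]
      push_cast
      module
    rw [hpt] at hμ hab
    rw [map_smul, smul_comm μ] at hμ
    refine hA.ne_smul_of_norm_ne_zero hv hne ?_ μ (smul_right_injective V hl0 hμ)
    have hex : (a + b * g' * x) ^ 2 - κ * (b * g' * y) ^ 2 =
      a ^ 2 + 2 * a * b * (g' * x) + (b * g') ^ 2 * (x ^ 2 - κ * y ^ 2) := by ring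
    have hg'0 : g' ≠ 0 := fun h0 => by simp [h0] at hg'x
    rw [hex]
    rcases ha.eq_or_lt with h0 | h0
    · rcases hb.eq_or_lt with h1 | h1
      · exfalso; simp [← h0, ← h1] at hab
      · have := mul_pos (by positivity : 0 < (b * g') ^ 2) hN
        simp only [← h0]
        nlinarith
    · have h1 := mul_nonneg (by positivity : 0 ≤ (b * g') ^ 2) hN.le
      have h2 : 0 ≤ 2 * a * b * (g' * x) := by positivity
      have h3 : 0 < a ^ 2 := by positivity
      linarith

/-! ### Comparison of two decompositions with the same product -/

/-- The diagonal coefficient of `A` at `v₂` in a form that exposes its dependence on `conj u₁ * u₂`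
and `τ` only. -/
theorem halfTrace_shift (u₁ u₂ : ℂ) (n₁ n₂ r : ℝ) :
    -((u₁.re * u₂.im - u₁.im * u₂.re : ℝ) : ℂ) +
      2 * Complex.I * u₁.im * u₂.im * (r / n₁ : ℝ) * (r / n₂ : ℝ) =
    Complex.I * (conj u₁ * u₂ - halfTrace u₁ u₂ n₁ n₂ r) := by
  rw [halfTrace]
  generalize r / n₁ = k₁
  generalize r / n₂ = k₂
  apply Complex.ext
  · simp; ring
  · simp; ring

namespace NormalPair

variable {h : V →ₗ[ℂ] V →ₗ⋆[ℂ] ℂ} {v₁ v₂ e f : V} {u₁ u₂ w₁ w₂ : ℂ} {n₁ n₂ r m₁ m₂ s : ℝ}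

/-- If the first centre is moved by an element of positive norm of `ℝ[A]`, then so is the second
one, up to a scalar. -/
theorem second_center (P : NormalPair h v₁ v₂ u₁ u₂ n₁ n₂ r) (Q : NormalPair h e f w₁ w₂ m₁ m₂ s)
    {S A : Module.End ℂ V} {τ : ℝ} (hS : rotation h u₂ v₂ * rotation h u₁ v₁ = S)
    (hS' : rotation h w₂ f * rotation h w₁ e = S) (hτ : halfTrace u₁ u₂ n₁ n₂ r = τ)
    (hτ' : halfTrace w₁ w₂ m₁ m₂ s = τ) (hA : skewPart S τ = A) (hu : u₁ * u₂ = w₁ * w₂)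
    (hs₁ : 0 < m₁ * n₁) (hs₂ : 0 < m₂ * n₂) {x y : ℝ} (hN : 0 < x ^ 2 - (1 - τ ^ 2) * y ^ 2)
    (he : e = (x : ℂ) • v₁ + (y : ℂ) • A v₁) :
    ∃ (ρ : ℂ) (x' y' : ℝ), f = ρ • ((x' : ℂ) • v₂ + (y' : ℂ) • A v₂) ∧
      0 < x' ^ 2 - (1 - τ ^ 2) * y' ^ 2 := by
  have a₂ := P.skewPart_apply₂
  have a₁ := Q.skewPart_apply₁
  have k0 := P.coeff_ne_zero₂
  have k0' := Q.coeff_ne_zero₁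
  have sq₂ : A (A v₂) = _ := P.skewPart_sq₂ (by rw [hS, hτ, hA])
  rw [halfTrace_shift, hτ, hS, hA] at a₂
  have hshift := halfTrace_shift w₁ w₂ m₁ m₂ s
  rw [hτ'] at hshift
  rw [hS', hτ', hA] at a₁
  rw [hτ] at sq₂
  set k := -2 * u₂ * u₁.im * ((r / n₁ : ℝ) : ℂ)
  set k' := -2 * conj w₁ * w₂.im * ((s / m₂ : ℝ) : ℂ)
  set μ : ℂ := Complex.I * (conj u₁ * u₂ - τ) with hμ
  set μ' : ℂ := Complex.I * (conj w₁ * w₂ - τ) with hμ'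
  have a₁' : A e = (-μ') • e + k' • f := by
    rw [a₁, ← hshift]
    congr 2
    ring
  -- From `k v₁ = (A - μ)v₂` and `k' f = (A + μ')e` one gets `k'k f = (A + μ')(x + yA)(A - μ)v₂`.
  -- The claim is that `(A + μ')(A - μ) = ρ(g₀ + g₁A)` with `g₀, g₁` real; `c₀` and `c₁` compare
  -- coefficients, and `u₁u₂ = w₁w₂` enters through `hw₂`.
  set ρ := conj w₁ * u₂ with hρ
  set g₀ : ℝ := 2 * ρ.re - 2 * τ * (w₁ * conj u₁).re with hg₀
  set g₁ : ℝ := -2 * (u₁ * conj w₁).im with hg₁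
  have U₁ := P.mul_conj₁
  have U₂ := P.mul_conj₂
  have W₁ := Q.mul_conj₁
  have hw₂ : w₂ = u₁ * u₂ * conj w₁ := by linear_combination - w₂ * W₁ - conj w₁ * hu
  have c₀ : ((1 - τ ^ 2 : ℝ) : ℂ) - μ * μ' = ρ * g₀ := by
    have e₁ : (g₀ : ℂ) = ρ + conj ρ - τ * (w₁ * conj u₁ + conj (w₁ * conj u₁)) := by
      rw [Complex.add_conj, Complex.add_conj, hg₀]; push_cast; ring
    rw [e₁, hμ, hμ', hρ, hw₂]
    simp only [map_mul, Complex.conj_conj]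
    push_cast
    linear_combination (-(conj u₁ * u₂ - τ) * (conj w₁ * (u₁ * u₂ * conj w₁) - τ)) * Complex.I_sq +
      conj w₁ ^ 2 * u₂ ^ 2 * U₁ - w₁ * conj w₁ * U₂ - W₁ + τ * u₂ * conj u₁ * W₁
  have c₁ : μ' - μ = ρ * g₁ := by
    have e₁ : (g₁ : ℂ) * Complex.I = -(u₁ * conj w₁ - conj (u₁ * conj w₁)) := by
      rw [Complex.sub_conj, hg₁]; push_cast; ring
    have e₂ : (g₁ : ℂ) = Complex.I * (u₁ * conj w₁ - conj u₁ * w₁) := by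
      simp only [map_mul, Complex.conj_conj] at e₁
      linear_combination -Complex.I * e₁ + g₁ * Complex.I_sq
    rw [e₂, hμ, hμ', hρ, hw₂]
    linear_combination Complex.I * conj u₁ * u₂ * W₁
  have hg : 0 < g₀ ^ 2 - (1 - τ ^ 2) * g₁ ^ 2 := by
    set a := u₁ * conj w₁ with ha
    have ra : (w₁ * conj u₁).re = a.re := by simp [ha]; ring
    have na : a.re ^ 2 + a.im ^ 2 = 1 := by
      simp only [ha, Complex.mul_re, Complex.mul_im, Complex.conj_re, Complex.conj_im]
      linear_combination (w₁.re ^ 2 + w₁.im ^ 2) * P.unit₁ + Q.unit₁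
    have nρ : ρ.re ^ 2 + ρ.im ^ 2 = 1 := by
      simp only [hρ, Complex.mul_re, Complex.mul_im, Complex.conj_re, Complex.conj_im]
      linear_combination (w₁.re ^ 2 + w₁.im ^ 2) * P.unit₂ + Q.unit₁
    have t₁ : τ - (ρ * conj a).re = -(2 * u₁.im * u₂.im * (r / n₁ * (r / n₂))) := by
      have : ρ * conj a = conj u₁ * u₂ := by
        simp only [hρ, ha, map_mul, Complex.conj_conj]
        linear_combination conj u₁ * u₂ * W₁
      rw [this, ← hτ, halfTrace]
      simp
    have t₂ : τ - (ρ * a).re = -(2 * w₁.im * w₂.im * (s / m₁ * (s / m₂))) := by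
      have : ρ * a = conj w₁ * w₂ := by
        rw [hρ, ha, hw₂]; ring
      rw [this, ← hτ', halfTrace]
      simp
    -- By `t₁` and `t₂` the factors have the signs of `-n₁n₂` and `-m₁m₂`, which agree because `mᵢnᵢ
    -- > 0`.
    have hprod : 0 < (τ - (ρ * conj a).re) * (τ - (ρ * a).re) := by
      have e₁ : (τ - (ρ * conj a).re) * (τ - (ρ * a).re) =
          4 * (u₁.im * u₂.im * w₁.im * w₂.im) * (r ^ 2 * s ^ 2) *
            ((m₁ * n₁) * (m₂ * n₂))⁻¹ := by
        rw [t₁, t₂]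
        simp only [div_eq_mul_inv, mul_inv]
        ring
      rw [e₁]
      have := P.im₁
      have := P.im₂
      have := Q.im₁
      have := Q.im₂
      have := P.pos
      have := Q.pos
      positivity
    have e₂ : g₀ ^ 2 - (1 - τ ^ 2) * g₁ ^ 2 = 4 * ((τ - (ρ * conj a).re) * (τ - (ρ * a).re)) := by
      rw [hg₀, hg₁, ra]
      simp only [Complex.mul_re, Complex.conj_re, Complex.conj_im]
      linear_combination (4 * τ ^ 2 - 4 * ρ.re ^ 2) * na + 4 * a.im ^ 2 * nρ
    rw [e₂]
    positivity
  have hf : (k' * k) • f = ρ • (((x * g₀ + (1 - τ ^ 2) * y * g₁ : ℝ) : ℂ) • v₂ +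
      ((x * g₁ + y * g₀ : ℝ) : ℂ) • A v₂) := by
    have hv : k • v₁ = A v₂ - μ • v₂ := by rw [a₂]; abel
    have h₁ : k' • f = A e + μ' • e := by rw [a₁']; module
    have h₂ : k • e = (y * (1 - τ ^ 2 : ℝ) - x * μ : ℂ) • v₂ + (x - y * μ : ℂ) • A v₂ := by
      rw [he, smul_add, smul_comm k, smul_comm k, ← map_smul, hv, map_sub, map_smul, sq₂]
      module
    have h₃ : (k' * k) • f = A (k • e) + μ' • (k • e) := by
      rw [mul_comm, mul_smul, h₁, smul_add, map_smul, smul_comm k]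
    rw [h₃, h₂, map_add, map_smul, map_smul, sq₂]
    match_scalars
    · push_cast at c₀ ⊢
      linear_combination y * c₀ + x * c₁
    · push_cast at c₀ ⊢
      linear_combination x * c₀ + y * (1 - τ ^ 2) * c₁
  refine ⟨(k' * k)⁻¹ * ρ, x * g₀ + (1 - τ ^ 2) * y * g₁, x * g₁ + y * g₀, ?_, ?_⟩
  · rw [mul_smul, ← hf, inv_smul_smul₀ (mul_ne_zero k0' k0)]
  -- Multiplicativity of the norm of `ℝ[A]`.
  · have : (x * g₀ + (1 - τ ^ 2) * y * g₁) ^ 2 - (1 - τ ^ 2) * (x * g₁ + y * g₀) ^ 2 =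
      (x ^ 2 - (1 - τ ^ 2) * y ^ 2) * (g₀ ^ 2 - (1 - τ ^ 2) * g₁ ^ 2) := by ring
    rw [this]
    positivity

theorem map (Q : NormalPair h e f w₁ w₂ m₁ m₂ s) {C : V →ₗ[ℂ] V}
    (hC : ∀ x y, h (C x) (C y) = h x y) : NormalPair h (C e) (C f) w₁ w₂ m₁ m₂ s :=
  { Q with
    self₁ := by rw [hC, Q.self₁]
    self₂ := by rw [hC, Q.self₂]
    cross := by rw [hC, Q.cross]
    cross' := by rw [hC, Q.cross'] }

end NormalPair

theorem rotation_map {h : V →ₗ[ℂ] V →ₗ⋆[ℂ] ℂ} {C : V →ₗ[ℂ] V}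
    (hC : ∀ x y, h (C x) (C y) = h x y) (u : ℂ) (v x : V) :
    rotation h u (C v) (C x) = C (rotation h u v x) := by
  simp only [rotation_apply, hC, map_add, map_smul]

theorem rotation_apply_of_orthogonal {h : V →ₗ[ℂ] V →ₗ⋆[ℂ] ℂ} (u : ℂ) {v x : V} (hx : h x v = 0) :
    rotation h u v x = u • x := by
  rw [rotation_apply, hx]; simp

namespace NormalPair

variable {h : V →ₗ[ℂ] V →ₗ⋆[ℂ] ℂ} {v₁ v₂ q₁ q₂ c : V} {u₁ u₂ w₁ w₂ : ℂ} {n₁ n₂ r m₁ m₂ s : ℝ}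

theorem fst_ne_zero (P : NormalPair h v₁ v₂ u₁ u₂ n₁ n₂ r) : v₁ ≠ 0 := fun h0 => by
  have := P.self₁
  rw [h0, map_zero] at this
  exact P.ne₁ (by exact_mod_cast this.symm)

/-- Both numbers are half the trace of the same operator on the same plane; the two Cayley–Hamilton
identities are compared at `q₁`. -/
theorem halfTrace_eq (P : NormalPair h v₁ v₂ u₁ u₂ n₁ n₂ r) (Q : NormalPair h q₁ q₂ w₁ w₂ m₁ m₂ s)
    (hS : rotation h u₂ v₂ * rotation h u₁ v₁ = rotation h w₂ q₂ * rotation h w₁ q₁)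
    (hv₁ : h v₁ c = 0) (hv₂ : h v₂ c = 0) (hq₁ : h q₁ c = 0)
    (hspan : ∀ x, h x c = 0 → ∃ a b : ℂ, x = a • v₁ + b • v₂) :
    halfTrace w₁ w₂ m₁ m₂ s = halfTrace u₁ u₂ n₁ n₂ r := by
  refine halfTrace_unique (S := rotation h w₂ q₂ * rotation h w₁ q₁) (v := q₁) ?_
    (Q.skewPart_sq₁ rfl) ?_
  · intro h0
    refine Q.skewPart_ne_smul₁ (Complex.I * halfTrace w₁ w₂ m₁ m₂ s) ?_
    rw [skewPart_apply, h0]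
    module
  · rw [← hS]
    exact (P.isAdapted hv₁ hv₂ hspan).sq q₁ hq₁

/-- The main construction: a second decomposition of the same product is moved by an isometry
commuting with the product so that its centres are obtained from `v₁`, `v₂` by elements of positive
norm of `ℝ[A]`. -/
theorem exists_isometry (hh : HasSignatureTwoOne h) (P : NormalPair h v₁ v₂ u₁ u₂ n₁ n₂ r)
    (Q : NormalPair h q₁ q₂ w₁ w₂ m₁ m₂ s) {S A : Module.End ℂ V} {τ : ℝ}
    (hS : rotation h u₂ v₂ * rotation h u₁ v₁ = S) (hS' : rotation h w₂ q₂ * rotation h w₁ q₁ = S)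
    (hτ : halfTrace u₁ u₂ n₁ n₂ r = τ) (hA : skewPart S τ = A) (hu : u₁ * u₂ = w₁ * w₂)
    (hs₁ : 0 < m₁ * n₁) (hs₂ : 0 < m₂ * n₂) (hc : h c c ≠ 0)
    (hv₁ : h v₁ c = 0) (hv₂ : h v₂ c = 0) (hq₁ : h q₁ c = 0)
    (hspan : ∀ x, h x c = 0 → ∃ a b : ℂ, x = a • v₁ + b • v₂) :
    ∃ D ∈ SU h, (∀ x, D (S x) = S (D x)) ∧
      (∃ (ρ : ℂ) (x y : ℝ), D q₁ = ρ • ((x : ℂ) • v₁ + (y : ℂ) • A v₁) ∧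
        0 < x ^ 2 - (1 - τ ^ 2) * y ^ 2) ∧
      ∃ (ρ : ℂ) (x y : ℝ), D q₂ = ρ • ((x : ℂ) • v₂ + (y : ℂ) • A v₂) ∧
        0 < x ^ 2 - (1 - τ ^ 2) * y ^ 2 := by
  have hτ' : halfTrace w₁ w₂ m₁ m₂ s = τ := by
    rw [← hτ]
    exact P.halfTrace_eq Q (by rw [hS, hS']) hv₁ hv₂ hq₁ hspan
  have had : IsAdapted h c A (1 - τ ^ 2) := by
    have := P.isAdapted hv₁ hv₂ hspan
    rwa [hS, hτ, hA] at this
  have hSA : ∀ x, S x = (τ : ℂ) • x + Complex.I • A x := fun x => by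
    rw [← hA, skewPart_apply, smul_smul, mul_neg, Complex.I_mul_I]
    module
  have hcv : ∀ x, h x c = 0 → h c x = 0 := fun x hx => by rw [← hh.conj_symm, hx, map_zero]
  have hAc : A c = (-Complex.I * (u₂ * u₁ - τ)) • c := by
    rw [← hA, skewPart_apply, ← hS, Module.End.mul_apply,
      rotation_apply_of_orthogonal _ (hcv _ hv₁), map_smul,
      rotation_apply_of_orthogonal _ (hcv _ hv₂)]
    module
  have a₁ := P.skewPart_apply₁
  rw [hτ, hS, hA] at a₁
  obtain ⟨z, w, hzw⟩ : ∃ z w : ℂ, q₁ = z • v₁ + w • A v₁ := by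
    obtain ⟨a, b, hab⟩ := hspan q₁ hq₁
    have k0 := P.coeff_ne_zero₁
    set k := -2 * conj u₁ * u₂.im * ((r / n₂ : ℝ) : ℂ)
    set l := ((u₁.re * u₂.im - u₁.im * u₂.re : ℝ) : ℂ) -
      2 * Complex.I * u₁.im * u₂.im * (r / n₁ : ℝ) * (r / n₂ : ℝ)
    refine ⟨a - b / k * l, b / k, ?_⟩
    rw [a₁, hab]
    match_scalars
    · ring
    · field_simp
  have hAAv : A (A v₁) = ((1 - τ ^ 2 : ℝ) : ℂ) • v₁ := had.sq v₁ hv₁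
  have hQne : ∀ μ : ℂ, A q₁ ≠ μ • q₁ := fun μ => by
    have := Q.skewPart_ne_smul₁ μ
    rwa [hS', hτ', hA] at this
  -- If `z² = κw²` with `w ≠ 0`, then `(z + wA)v₁` is an eigenvector of `A` with eigenvalue `z/w`,
  -- but `q₁` is not fixed.
  have hΔ : z ^ 2 - ((1 - τ ^ 2 : ℝ) : ℂ) * w ^ 2 ≠ 0 := by
    intro h0
    by_cases hw : w = 0
    · have hz : z = 0 := by simpa [hw] using h0
      exact Q.fst_ne_zero (by rw [hzw, hz, hw]; simp)
    · refine hQne (z / w) ?_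
      rw [← (smul_right_injective V hw).eq_iff]
      change w • A q₁ = w • _
      rw [smul_smul, mul_div_cancel₀ _ hw, hzw, map_add, map_smul, map_smul, hAAv]
      match_scalars
      · ring
      · push_cast at h0 ⊢
        linear_combination -h0
  have hn : 0 < n₁ ^ 2 := by have := P.ne₁; positivity
  -- When `Re(z conj w) = 0`, the term with `⟨v₁, A v₁⟩` drops out of `⟨q₁, q₁⟩`, leaving `(|z|² +
  -- κ|w|²)n₁`; the equal signatures decide the sign.
  have hsign : (z * conj w).re = 0 →
      0 < Complex.normSq z + (1 - τ ^ 2) * Complex.normSq w := by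
    intro h0
    have hAA : h (A v₁) (A v₁) = ((1 - τ ^ 2 : ℝ) : ℂ) * n₁ := by
      rw [← had.adj _ _ (had.perp _ hv₁) hv₁, hAAv, map_smul, LinearMap.smul_apply, smul_eq_mul,
        P.self₁]
    have hzw0 : z * conj w + w * conj z = 0 := by
      have := Complex.add_conj (z * conj w)
      rw [h0] at this
      simpa [mul_comm] using this
    have e := Q.self₁
    rw [hzw] at e
    simp only [map_add, map_smul, LinearMap.add_apply, LinearMap.smul_apply,
      LinearMap.map_smulₛₗ, smul_eq_mul, hAA, had.adj v₁ v₁ hv₁ hv₁, P.self₁] at e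
    have e' : (m₁ : ℂ) = (Complex.normSq z + ((1 - τ ^ 2 : ℝ) : ℂ) * Complex.normSq w) * n₁ := by
      rw [← Complex.mul_conj, ← Complex.mul_conj, ← e]
      linear_combination (h v₁) (A v₁) * hzw0
    have e'' : m₁ = (Complex.normSq z + (1 - τ ^ 2) * Complex.normSq w) * n₁ := by
      exact_mod_cast e'
    rw [e'', mul_assoc, ← sq] at hs₁
    exact (pos_iff_pos_of_mul_pos hs₁).2 hn
  obtain ⟨x, y, b₀, b₁, hb, hb', hx, hy, hN⟩ := exists_unitary_coeffs (1 - τ ^ 2) z w hΔ hsign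
  obtain ⟨C, hC, hCA, hCp⟩ := had.exists_isometry hh hc hb hb' hAc
  have hCq : C q₁ = (x : ℂ) • v₁ + (y : ℂ) • A v₁ := by
    rw [hCp q₁ hq₁, hzw, map_add, map_smul, map_smul, hAAv, ← hx, ← hy]
    module
  have hCS : ∀ x, C (S x) = S (C x) := fun x => by
    rw [hSA, hSA, map_add, map_smul, map_smul, hCA]
  obtain ⟨D, l, hD, hl, hDC⟩ := hh.exists_mem_SU hC
  have hS'' : rotation h w₂ (C q₂) * rotation h w₁ (C q₁) = S := by
    have hinj : Function.Injective C := by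
      intro a b hab
      have : D a = D b := by rw [hDC, hDC, hab]
      exact D.injective this
    have hfin : FiniteDimensional ℂ V :=
      Module.finite_of_finrank_pos (by rw [hh.finrank]; norm_num)
    have hsurj := LinearMap.injective_iff_surjective.1 hinj
    ext a
    obtain ⟨a, rfl⟩ := hsurj a
    rw [Module.End.mul_apply, rotation_map hC, rotation_map hC, ← hCS, ← hS']
    rfl
  obtain ⟨ρ, x', y', hf, hN'⟩ := P.second_center (Q.map hC) hS hS'' hτ hτ' hA hu hs₁ hs₂ hN hCq
  refine ⟨D, hD, fun x => ?_, ⟨l, x, y, ?_, hN⟩, ⟨l * ρ, x', y', ?_, hN'⟩⟩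
  · rw [hDC, hDC, hCS, map_smul]
  · rw [hDC, hCq]
  · rw [hDC, hf, mul_smul]

end NormalPair

/-! ### Invariance under isometries -/

section Invariance

variable {h : V →ₗ[ℂ] V →ₗ⋆[ℂ] ℂ} {D : V ≃ₗ[ℂ] V}

theorem signature_act (hD : ∀ x y, h (D x) (D y) = h x y) (p : ℙ ℂ V) :
    signature h (act D p) = signature h p := by
  induction p using Projectivization.ind with | h v hv => ?_
  rw [act_mk, signature_mk, signature_mk, hD]

theorem orthogonal_act (hD : ∀ x y, h (D x) (D y) = h x y) (p q : ℙ ℂ V) :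
    Orthogonal h (act D p) (act D q) ↔ Orthogonal h p q := by
  induction p using Projectivization.ind with | h v hv => ?_
  induction q using Projectivization.ind with | h w hw => ?_
  rw [act_mk, act_mk, orthogonal_mk, orthogonal_mk, hD]

theorem apply_mem_line_act {p q : ℙ ℂ V} {x : V} : D x ∈ line (act D p) (act D q) ↔ x ∈ line p q := by
  induction p using Projectivization.ind with | h v hv => ?_
  induction q using Projectivization.ind with | h w hw => ?_
  rw [act_mk, act_mk, mem_line_mk, mem_line_mk]
  refine exists_congr fun a => exists_congr fun b => ?_
  rw [← map_smul, ← map_smul, ← map_add, D.injective.eq_iff]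

theorem isEuclidean_line_act (hD : ∀ x y, h (D x) (D y) = h x y) {p q : ℙ ℂ V}
    (hE : IsEuclidean h (line (act D p) (act D q))) : IsEuclidean h (line p q) := by
  obtain ⟨v, hv, hv0, hvw⟩ := hE
  obtain ⟨v, rfl⟩ := D.surjective v
  refine ⟨v, apply_mem_line_act.1 hv, fun h0 => hv0 (by rw [h0, map_zero]), fun w hw => ?_⟩
  rw [← hD]
  exact hvw _ (apply_mem_line_act.2 hw)

theorem act_injective : Function.Injective (act D) :=
  Projectivization.map_injective _ D.injective

theorem Config.Generic.act {X : Config V} (hX : X.Generic h)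
    (hD : ∀ x y, h (D x) (D y) = h x y) :
    (⟨act D X.p₁, act D X.p₂, X.α₁, X.α₂⟩ : Config V).Generic h where
  ne := fun e => hX.ne (act_injective e)
  nonisotropic₁ := by rw [signature_act hD]; exact hX.nonisotropic₁
  nonisotropic₂ := by rw [signature_act hD]; exact hX.nonisotropic₂
  nonorthogonal := by rw [orthogonal_act hD]; exact hX.nonorthogonal
  noneuclidean := fun e => hX.noneuclidean (isEuclidean_line_act hD e)
  param₁ := hX.param₁
  param₂ := hX.param₂

theorem specialElliptic_act (hD : ∀ x y, h (D x) (D y) = h x y) (α : Circle) (p : ℙ ℂ V) (x : V) :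
    specialElliptic h α (ComplexHyperbolic.act D p) (D x) = D (specialElliptic h α p x) := by
  induction p using Projectivization.ind with | h v hv => ?_
  rw [act_mk, specialElliptic_mk, specialElliptic_mk, hD, hD]
  simp only [map_add, map_smul]

theorem Config.prod_act (hD : ∀ x y, h (D x) (D y) = h x y) (X : Config V) (x : V) :
    Config.prod h ⟨ComplexHyperbolic.act D X.p₁, ComplexHyperbolic.act D X.p₂, X.α₁, X.α₂⟩ (D x) =
      D (X.prod h x) := by
  simp only [Config.prod, Module.End.mul_apply, specialElliptic_act hD]

theorem act_symm_act (p : ℙ ℂ V) :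
    ComplexHyperbolic.act D⁻¹ (ComplexHyperbolic.act D p) = p := by
  induction p using Projectivization.ind with | h v hv => ?_
  rw [act_mk, act_mk]
  congr 1
  exact D.symm_apply_apply v

end Invariance

/-! ### Rotations are isometries -/

theorem rotation_isometry {h : V →ₗ[ℂ] V →ₗ⋆[ℂ] ℂ} (hh : HasSignatureTwoOne h) {u : ℂ} {v : V}
    {n : ℝ} (hn : h v v = n) (hn0 : n ≠ 0) (hu : u * conj u = 1) (x y : V) :
    h (rotation h u v x) (rotation h u v y) = h x y := by
  have hn0' : (n : ℂ) ≠ 0 := by exact_mod_cast hn0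
  simp only [rotation_apply, map_add, map_smul, LinearMap.add_apply, LinearMap.smul_apply,
    LinearMap.map_smulₛₗ, smul_eq_mul, hn, map_mul, map_sub, map_div₀, Complex.conj_conj,
    Complex.conj_ofReal, hh.conj_symm y v]
  field_simp
  linear_combination (n * h x y) * hu

/-- The eigenvalue `u₁ u₂` of the product, which is attained at the polar vector of the plane of the
centres, is not attained on this plane. -/
theorem NormalPair.eq_zero_of_eigenvector {h : V →ₗ[ℂ] V →ₗ⋆[ℂ] ℂ} {v₁ v₂ : V} {u₁ u₂ : ℂ}
    {n₁ n₂ r : ℝ} (P : NormalPair h v₁ v₂ u₁ u₂ n₁ n₂ r) {a b : ℂ}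
    (he : (rotation h u₂ v₂ * rotation h u₁ v₁) (a • v₁ + b • v₂) =
      (u₁ * u₂) • (a • v₁ + b • v₂)) : a = 0 ∧ b = 0 := by
  set p := a • v₁ + b • v₂ with hp
  have hn₁ : (n₁ : ℂ) ≠ 0 := by exact_mod_cast P.ne₁
  have hn₂ : (n₂ : ℂ) ≠ 0 := by exact_mod_cast P.ne₂
  have hc : ∀ u : ℂ, 0 < u.im → conj u - u ≠ 0 := fun u hu h0 => by
    have := congrArg Complex.im h0
    simp at this
    linarith
  rw [Module.End.mul_apply, rotation_apply h u₁, map_add, map_smul, map_smul, rotation_apply,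
    rotation_apply, P.self₁, P.self₂, P.cross] at he
  set ξ := (conj u₁ - u₁) * (h p v₁ / n₁) with hξ
  -- The `p`-terms on both sides cancel. Independence of `v₁, v₂` then makes `p` orthogonal to `v₁`
  -- and afterwards to `v₂`.
  have e : (ξ * u₂) • v₁ + (u₁ * ((conj u₂ - u₂) * (h p v₂ / n₂)) +
      ξ * ((conj u₂ - u₂) * (r / n₂))) • v₂ = 0 := by
    rw [← sub_eq_zero] at he
    refine Eq.trans ?_ he
    module
  obtain ⟨e₁, e₂⟩ := P.linearIndep e
  have hξ0 : ξ = 0 := (mul_eq_zero.1 e₁).resolve_right P.unit_ne_zero₂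
  rw [hξ0, zero_mul, add_zero] at e₂
  refine P.eq_zero_of_orthogonal ?_ ?_
  · have := (mul_eq_zero.1 (hξ ▸ hξ0)).resolve_left (hc u₁ P.im₁)
    exact (div_eq_zero_iff.1 this).resolve_right hn₁
  · have := (mul_eq_zero.1 ((mul_eq_zero.1 e₂).resolve_left P.unit_ne_zero₁)).resolve_left
      (hc u₂ P.im₂)
    exact (div_eq_zero_iff.1 this).resolve_right hn₂

/-- If proportional products have nonorthogonal planes of centres, then these planes are equal. -/
theorem NormalPair.same_plane {h : V →ₗ[ℂ] V →ₗ⋆[ℂ] ℂ} (hh : HasSignatureTwoOne h)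
    {v₁ v₂ q₁ q₂ c c' : V} {u₁ u₂ w₁ w₂ l l' : ℂ} {n₁ n₂ r m₁ m₂ s : ℝ}
    (P : NormalPair h v₁ v₂ u₁ u₂ n₁ n₂ r) (Q : NormalPair h q₁ q₂ w₁ w₂ m₁ m₂ s)
    (hl : l * conj l = 1) (hl' : l' * conj l' = 1)
    (hS : l • (rotation h u₂ v₂ * rotation h u₁ v₁) = l' • (rotation h w₂ q₂ * rotation h w₁ q₁))
    (hc : h c c ≠ 0) (hv₁ : h v₁ c = 0) (hv₂ : h v₂ c = 0)
    (hspan : ∀ x, h x c = 0 → ∃ a b : ℂ, x = a • v₁ + b • v₂)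
    (hq₁ : h q₁ c' = 0) (hq₂ : h q₂ c' = 0) (hcc' : h c c' ≠ 0) :
    l * (u₁ * u₂) = l' * (w₁ * w₂) ∧ h q₁ c = 0 ∧ h q₂ c = 0 := by
  have hsymm : ∀ {x y : V}, h x y = 0 → h y x = 0 := fun {x y} hx => by
    rw [← hh.conj_symm, hx, map_zero]
  have hSc : (rotation h u₂ v₂ * rotation h u₁ v₁) c = (u₁ * u₂) • c := by
    rw [Module.End.mul_apply, rotation_apply_of_orthogonal _ (hsymm hv₁), map_smul,
      rotation_apply_of_orthogonal _ (hsymm hv₂), smul_smul]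
  have hSc' : (rotation h w₂ q₂ * rotation h w₁ q₁) c' = (w₁ * w₂) • c' := by
    rw [Module.End.mul_apply, rotation_apply_of_orthogonal _ (hsymm hq₁), map_smul,
      rotation_apply_of_orthogonal _ (hsymm hq₂), smul_smul]
  have hS₁ : ∀ x, l • (rotation h u₂ v₂ * rotation h u₁ v₁) x =
      l' • (rotation h w₂ q₂ * rotation h w₁ q₁) x := fun x => LinearMap.congr_fun hS x
  -- Eigenvectors of an isometry that are not orthogonal and have unimodular eigenvalues share their
  -- eigenvalue.
  have hδ : l * (u₁ * u₂) = l' * (w₁ * w₂) := by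
    have e : h (l • (rotation h u₂ v₂ * rotation h u₁ v₁) c)
        (l • (rotation h u₂ v₂ * rotation h u₁ v₁) c') = h c c' := by
      rw [apply_smul_smul, hl, one_mul, Module.End.mul_apply, Module.End.mul_apply,
        rotation_isometry hh P.self₂ P.ne₂ P.mul_conj₂,
        rotation_isometry hh P.self₁ P.ne₁ P.mul_conj₁]
    rw [hS₁ c', hSc, hSc', smul_smul, smul_smul, apply_smul_smul] at e
    have e₁ : l * (u₁ * u₂) * conj (l' * (w₁ * w₂)) = 1 :=
      mul_right_cancel₀ hcc' (by rw [e, one_mul])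
    have e₂ : l' * (w₁ * w₂) * conj (l' * (w₁ * w₂)) = 1 := by
      simp only [map_mul]
      linear_combination w₁ * w₂ * conj w₁ * conj w₂ * hl' + w₂ * conj w₂ * Q.mul_conj₁ +
        Q.mul_conj₂
    have e₃ : conj (l' * (w₁ * w₂)) ≠ 0 := fun h0 => by simp [h0] at e₁
    exact mul_right_cancel₀ e₃ (e₁.trans e₂.symm)
  have hl0 : l ≠ 0 := fun h0 => by simp [h0] at hl
  set z := h c' c / h c c with hz
  have hp : h (c' - z • c) c = 0 := by
    rw [map_sub, map_smul, LinearMap.sub_apply, LinearMap.smul_apply, smul_eq_mul, hz,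
      div_mul_cancel₀ _ hc, sub_self]
  -- The component of `c'` in the plane `c^⊥` also has the eigenvalue `u₁u₂`, so it vanishes and
  -- `c'` is proportional to `c`.
  have heig : (rotation h u₂ v₂ * rotation h u₁ v₁) (c' - z • c) = (u₁ * u₂) • (c' - z • c) := by
    refine smul_right_injective V hl0 ?_
    change l • _ = l • _
    rw [map_sub, map_smul, hSc, smul_sub, hS₁, hSc', smul_smul, ← hδ]
    module
  obtain ⟨a, b, hab⟩ := hspan _ hp
  rw [hab] at heig
  obtain ⟨rfl, rfl⟩ := P.eq_zero_of_eigenvector heig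
  have hc'z : c' = z • c := by
    rw [zero_smul, zero_smul, add_zero, sub_eq_zero] at hab
    exact hab
  rw [hc'z, LinearMap.map_smulₛₗ, smul_eq_mul] at hq₁ hq₂ hcc'
  have hz0 := left_ne_zero_of_mul hcc'
  exact ⟨hδ, (mul_eq_zero.1 hq₁).resolve_left hz0, (mul_eq_zero.1 hq₂).resolve_left hz0⟩

/-! ### Geodesics -/

theorem mk_mem_realSpan {v w e : V} (he : e ≠ 0) {ρ : ℂ} {x y : ℝ}
    (h : e = ρ • ((x : ℂ) • v + (y : ℂ) • w)) : Projectivization.mk ℂ e he ∈ realSpan v w := by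
  have hρ : ρ ≠ 0 := fun h0 => he (by rw [h, h0, zero_smul])
  have hne : (x : ℂ) • v + (y : ℂ) • w ≠ 0 := fun h0 => he (by rw [h, h0, smul_zero])
  exact ⟨x, y, hne, (Projectivization.mk_eq_mk_iff' ℂ _ _ he hne).2 ⟨ρ, h.symm⟩⟩

theorem realSpan_subset {v w v' w' : V} {a b c d : ℝ} (hv : v = (a : ℂ) • v' + (b : ℂ) • w')
    (hw : w = (c : ℂ) • v' + (d : ℂ) • w') : realSpan v w ⊆ realSpan v' w' := by
  rintro _ ⟨x, y, hne, rfl⟩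
  refine mk_mem_realSpan hne (ρ := 1) (x := x * a + y * c) (y := x * b + y * d) ?_
  rw [hv, hw]
  push_cast
  module

theorem realSpan_comm (v w : V) : realSpan v w = realSpan w v :=
  Set.Subset.antisymm
    (realSpan_subset (a := 0) (b := 1) (c := 1) (d := 0) (by simp) (by simp))
    (realSpan_subset (a := 0) (b := 1) (c := 1) (d := 0) (by simp) (by simp))

theorem realSpan_sub_smul (v w : V) (t : ℝ) : realSpan v (w - (t : ℂ) • v) = realSpan v w :=
  Set.Subset.antisymm
    (realSpan_subset (a := 1) (b := 0) (c := -t) (d := 1) (by simp)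
      (by push_cast; module))
    (realSpan_subset (a := 1) (b := 0) (c := t) (d := 1) (by simp) (by simp))

namespace NormalPair

variable {h : V →ₗ[ℂ] V →ₗ⋆[ℂ] ℂ} {v₁ v₂ : V} {u₁ u₂ : ℂ} {n₁ n₂ r : ℝ}

/-- The component of `v₂` orthogonal to `v₁` is the direction of `G` at the first centre; `conj u₁`
turns it back by `θ` to the direction of `G₁`. -/
theorem hasAngle₁ (P : NormalPair h v₁ v₂ u₁ u₂ n₁ n₂ r) {hv₁ : v₁ ≠ 0} {θ : ℝ} (h0 : 0 ≤ θ)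
    (hπ : θ < Real.pi) (hθ : (Circle.exp θ : ℂ) = u₁) :
    HasAngle h (Projectivization.mk ℂ v₁ hv₁)
      (realSpan v₁ (conj u₁ • (v₂ - ((r / n₁ : ℝ) : ℂ) • v₁))) (realSpan v₁ v₂) θ := by
  have hn₁ : (n₁ : ℂ) ≠ 0 := by exact_mod_cast P.ne₁
  have hD : (n₁ * n₂ - r ^ 2 : ℂ) ≠ 0 := by exact_mod_cast P.disc
  have hu : conj u₁ ≠ 0 := by simpa using P.unit_ne_zero₁
  refine ⟨h0, hπ, v₁, _, hv₁, rfl, ?_, ?_, ?_, rfl, ?_⟩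
  · rw [P.self₁]; exact hn₁
  · rw [apply_smul_smul]
    refine mul_ne_zero (mul_ne_zero hu (by simpa using P.unit_ne_zero₁)) ?_
    simp only [map_sub, map_smul, LinearMap.sub_apply, LinearMap.smul_apply,
      LinearMap.map_smulₛₗ, smul_eq_mul, P.self₁, P.self₂, P.cross, P.cross', Complex.conj_ofReal]
    intro h0
    apply hD
    push_cast at h0
    field_simp at h0
    linear_combination h0
  · simp only [map_sub, LinearMap.map_smulₛₗ, smul_eq_mul, P.self₁, P.cross, Complex.conj_ofReal]
    push_cast
    field_simp
    simp
  · rw [hθ, smul_smul, P.mul_conj₁, one_smul, realSpan_sub_smul]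

theorem hasAngle₂ (P : NormalPair h v₁ v₂ u₁ u₂ n₁ n₂ r) {hv₂ : v₂ ≠ 0} {θ : ℝ} (h0 : 0 ≤ θ)
    (hπ : θ < Real.pi) (hθ : (Circle.exp θ : ℂ) = u₂) :
    HasAngle h (Projectivization.mk ℂ v₂ hv₂) (realSpan v₁ v₂)
      (realSpan v₂ (u₂ • (v₁ - ((r / n₂ : ℝ) : ℂ) • v₂))) θ := by
  have hn₂ : (n₂ : ℂ) ≠ 0 := by exact_mod_cast P.ne₂
  have hD : (n₁ * n₂ - r ^ 2 : ℂ) ≠ 0 := by exact_mod_cast P.disc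
  refine ⟨h0, hπ, v₂, v₁ - ((r / n₂ : ℝ) : ℂ) • v₂, hv₂, rfl, ?_, ?_, ?_, ?_, ?_⟩
  · rw [P.self₂]; exact hn₂
  · simp only [map_sub, map_smul, LinearMap.sub_apply, LinearMap.smul_apply,
      LinearMap.map_smulₛₗ, smul_eq_mul, P.self₁, P.self₂, P.cross, P.cross', Complex.conj_ofReal]
    intro h0
    apply hD
    push_cast at h0
    field_simp at h0
    linear_combination h0
  · simp only [map_sub, LinearMap.map_smulₛₗ, smul_eq_mul, P.self₂, P.cross', Complex.conj_ofReal]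
    push_cast
    field_simp
    simp
  · rw [realSpan_sub_smul, realSpan_comm]
  · rw [hθ]

/-- The first associated geodesic is the projectivization of `ℝ[A] v₁`. -/
theorem mem_realSpan₁ (P : NormalPair h v₁ v₂ u₁ u₂ n₁ n₂ r) {A : Module.End ℂ V}
    (hA : A = skewPart (rotation h u₂ v₂ * rotation h u₁ v₁) (halfTrace u₁ u₂ n₁ n₂ r))
    {e : V} (he : e ≠ 0) {ρ : ℂ} {x y : ℝ} (hxy : e = ρ • ((x : ℂ) • v₁ + (y : ℂ) • A v₁)) :
    Projectivization.mk ℂ e he ∈ realSpan v₁ (conj u₁ • (v₂ - ((r / n₁ : ℝ) : ℂ) • v₁)) := by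
  have a₁ : A v₁ = _ := hA ▸ P.skewPart_apply₁
  refine realSpan_subset (v := v₁) (w := A v₁) (a := 1) (b := 0)
    (c := u₁.re * u₂.im - u₁.im * u₂.re - 2 * u₁.re * u₂.im * (r / n₁) * (r / n₂))
    (d := -2 * u₂.im * (r / n₂)) (by simp) ?_ (mk_mem_realSpan he hxy)
  rw [a₁]
  generalize r / n₁ = k₁
  generalize r / n₂ = k₂
  match_scalars
  · apply Complex.ext
    · simp; ring
    · simp; ring
  · ring

/-- The second associated geodesic is the projectivization of `ℝ[A] v₂`. -/
theorem mem_realSpan₂ (P : NormalPair h v₁ v₂ u₁ u₂ n₁ n₂ r) {A : Module.End ℂ V}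
    (hA : A = skewPart (rotation h u₂ v₂ * rotation h u₁ v₁) (halfTrace u₁ u₂ n₁ n₂ r))
    {e : V} (he : e ≠ 0) {ρ : ℂ} {x y : ℝ} (hxy : e = ρ • ((x : ℂ) • v₂ + (y : ℂ) • A v₂)) :
    Projectivization.mk ℂ e he ∈ realSpan v₂ (u₂ • (v₁ - ((r / n₂ : ℝ) : ℂ) • v₂)) := by
  have a₂ : A v₂ = _ := hA ▸ P.skewPart_apply₂
  refine realSpan_subset (v := v₂) (w := A v₂) (a := 1) (b := 0)
    (c := -(u₁.re * u₂.im - u₁.im * u₂.re) - 2 * u₂.re * u₁.im * (r / n₁) * (r / n₂))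
    (d := -2 * u₁.im * (r / n₁)) (by simp) ?_ (mk_mem_realSpan he hxy)
  rw [a₂]
  generalize r / n₁ = k₁
  generalize r / n₂ = k₂
  match_scalars
  · ring
  · apply Complex.ext
    · simp; ring
    · simp; ring

end NormalPair

theorem Config.Generic.exists_normalPair {h : V →ₗ[ℂ] V →ₗ⋆[ℂ] ℂ} (hh : HasSignatureTwoOne h)
    {X : Config V} (hX : X.Generic h) :
    ∃ (v₁ v₂ : V) (hv₁ : v₁ ≠ 0) (hv₂ : v₂ ≠ 0) (n₁ n₂ r : ℝ),
      X.p₁ = Projectivization.mk ℂ v₁ hv₁ ∧ X.p₂ = Projectivization.mk ℂ v₂ hv₂ ∧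
      geodesic h X.p₁ X.p₂ = realSpan v₁ v₂ ∧
      signature h X.p₁ = SignType.sign n₁ ∧ signature h X.p₂ = SignType.sign n₂ ∧
      ∀ u₁ u₂ : Circle, 0 < (u₁ : ℂ).im → 0 < (u₂ : ℂ).im → NormalPair h v₁ v₂ u₁ u₂ n₁ n₂ r := by
  set v₁ := X.p₁.rep with hv₁'
  set z := h X.p₁.rep X.p₂.rep with hz
  have hz0 : z ≠ 0 := hX.nonorthogonal
  -- This scaling makes `⟨v₁, v₂⟩ = |z|²` positive and is the one used in `geodesic`.
  set v₂ := z • X.p₂.rep with hv₂'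
  have hv₁ : v₁ ≠ 0 := Projectivization.rep_nonzero _
  have hv₂ : v₂ ≠ 0 := smul_ne_zero hz0 (Projectivization.rep_nonzero _)
  have e₁ : X.p₁ = Projectivization.mk ℂ v₁ hv₁ := (Projectivization.mk_rep _).symm
  have e₂ : X.p₂ = Projectivization.mk ℂ v₂ hv₂ := by
    conv_lhs => rw [← Projectivization.mk_rep X.p₂]
    exact ((Projectivization.mk_eq_mk_iff' ℂ _ _ _ _).2 ⟨z, rfl⟩).symm
  have s₁ : signature h X.p₁ = SignType.sign (h v₁ v₁).re := by rw [e₁, signature_mk]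
  have s₂ : signature h X.p₂ = SignType.sign (h v₂ v₂).re := by rw [e₂, signature_mk]
  have n₁0 : (h v₁ v₁).re ≠ 0 := fun h0 => hX.nonisotropic₁ (by rw [s₁, h0, sign_zero])
  have n₂0 : (h v₂ v₂).re ≠ 0 := fun h0 => hX.nonisotropic₂ (by rw [s₂, h0, sign_zero])
  have hcross : h v₁ v₂ = (Complex.normSq z : ℝ) := by
    rw [hv₂', LinearMap.map_smulₛₗ, smul_eq_mul, ← Complex.mul_conj, mul_comm]
  have hcross' : h v₂ v₁ = (Complex.normSq z : ℝ) := by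
    rw [← hh.conj_symm, hcross, Complex.conj_ofReal]
  have h11 := hh.self_real v₁
  have h22 := hh.self_real v₂
  set n₁ := (h v₁ v₁).re
  set n₂ := (h v₂ v₂).re
  have hunit : ∀ u : Circle, (u : ℂ).re ^ 2 + (u : ℂ).im ^ 2 = 1 := fun u => by
    have := Circle.normSq_coe u
    rw [Complex.normSq_apply] at this
    linarith
  have hn₁ : (n₁ : ℂ) ≠ 0 := by exact_mod_cast n₁0
  refine ⟨v₁, v₂, hv₁, hv₂, n₁, n₂, Complex.normSq z, e₁, e₂, rfl, s₁, s₂,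
    fun u₁ u₂ i₁ i₂ => ⟨h11.symm, h22.symm, hcross, hcross', n₁0, n₂0, Complex.normSq_pos.2 hz0, ?_,
      hunit _, hunit _, i₁, i₂⟩⟩
  intro hD
  have hD' : (n₁ * n₂ - (Complex.normSq z) ^ 2 : ℂ) = 0 := by exact_mod_cast hD
  apply hX.noneuclidean
  -- `v₂ - t v₁` is orthogonal to `v₁`, and also to `v₂` if the Gram determinant vanishes; it then
  -- spans the radical of the plane.
  set t : ℂ := Complex.normSq z / n₁ with ht
  refine ⟨v₂ - t • v₁, ?_, ?_, ?_⟩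
  · rw [e₁, e₂, mem_line_mk]
    exact ⟨-t, 1, by module⟩
  · intro h0
    have hv : v₂ = t • v₁ := sub_eq_zero.1 h0
    apply hX.ne
    rw [e₁, e₂]
    exact ((Projectivization.mk_eq_mk_iff' ℂ _ _ _ _).2 ⟨t, hv.symm⟩).symm
  · intro w hw
    rw [e₁, e₂, mem_line_mk] at hw
    obtain ⟨a, b, rfl⟩ := hw
    simp only [map_add, map_sub, map_smul, LinearMap.sub_apply, LinearMap.smul_apply,
      LinearMap.map_smulₛₗ, smul_eq_mul, hcross, hcross', ← h11, ← h22, ht]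
    field_simp
    linear_combination conj b * hD'

/-! ### Parameters -/

/-- The parameter `ω ^ j exp (iθ)` in the arc `I_j`. -/
def param (j : ℕ) (θ : ℝ) : Circle := Circle.exp (2 * Real.pi / 3) ^ j * Circle.exp θ

/-- The scalar relating `R_α` to the rotation by `rotParam θ`. -/
def scaleParam (j : ℕ) (θ : ℝ) : Circle := Circle.exp (2 * Real.pi / 3) ^ j * Circle.exp (-(θ / 2))

/-- The cube of the primitive `exp (iθ/2)` of `param j θ`. -/
def rotParam (θ : ℝ) : Circle := Circle.exp (θ / 2) ^ 3

theorem omega_pow_three : Circle.exp (2 * Real.pi / 3) ^ 3 = 1 := by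
  rw [← Circle.exp_nsmul, nsmul_eq_mul]
  norm_num
  rw [mul_div_cancel₀ _ (by norm_num), Circle.exp_two_pi]

theorem scaleParam_mul_rotParam (j : ℕ) (θ : ℝ) : scaleParam j θ * rotParam θ = param j θ := by
  rw [scaleParam, rotParam, param, mul_assoc, ← Circle.exp_nsmul (θ / 2), ← Circle.exp_add, nsmul_eq_mul]
  congr 2
  push_cast
  ring

theorem scaleParam_mul_inv_rotParam (j : ℕ) (θ : ℝ) :
    scaleParam j θ * (rotParam θ)⁻¹ = (param j θ ^ 2)⁻¹ := by
  rw [eq_inv_iff_mul_eq_one, ← scaleParam_mul_rotParam]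
  have : scaleParam j θ * (rotParam θ)⁻¹ * (scaleParam j θ * rotParam θ) ^ 2 =
      scaleParam j θ ^ 3 * rotParam θ := by
    have := Circle.coe_ne_zero (rotParam θ)
    apply Circle.ext
    push_cast
    field_simp
  rw [this, scaleParam, rotParam, mul_pow, ← pow_mul, mul_comm j, pow_mul, omega_pow_three, one_pow,
    one_mul, ← mul_pow, ← Circle.exp_add]
  simp

theorem isPrimitive_param (j : ℕ) {θ : ℝ} (h0 : 0 < θ) (h1 : θ < 2 * Real.pi / 3) :
    IsPrimitive (Circle.exp (θ / 2)) (param j θ) := by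
  refine ⟨⟨θ / 2, by linarith, by linarith, rfl⟩, ?_⟩
  rw [param, mul_pow, ← pow_mul _ j, mul_comm j, pow_mul, omega_pow_three, one_pow, one_mul,
    ← Circle.exp_nsmul (θ / 2) 2, nsmul_eq_mul]
  congr 2
  push_cast
  ring

theorem rotParam_im_pos {θ : ℝ} (h0 : 0 < θ) (h1 : θ < 2 * Real.pi / 3) :
    0 < (rotParam θ : ℂ).im := by
  rw [rotParam, ← Circle.exp_nsmul, Circle.coe_exp, Complex.exp_ofReal_mul_I_im, nsmul_eq_mul]
  apply Real.sin_pos_of_pos_of_lt_pi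
  · push_cast; linarith
  · push_cast; linarith

/-- If the products of two parameters from the same arcs are equal, then so are the sums of their
arguments. -/
theorem add_eq_add_of_param_mul_eq {j k : ℕ} {θ₁ θ₂ φ₁ φ₂ : ℝ}
    (h : param j θ₁ * param k θ₂ = param j φ₁ * param k φ₂)
    (h1 : 0 < θ₁) (h2 : θ₁ < 2 * Real.pi / 3) (h3 : 0 < θ₂) (h4 : θ₂ < 2 * Real.pi / 3)
    (h5 : 0 < φ₁) (h6 : φ₁ < 2 * Real.pi / 3) (h7 : 0 < φ₂) (h8 : φ₂ < 2 * Real.pi / 3) :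
    θ₁ + θ₂ = φ₁ + φ₂ := by
  simp only [param] at h
  rw [mul_mul_mul_comm, mul_mul_mul_comm _ (Circle.exp φ₁), mul_left_cancel_iff, ← Circle.exp_add,
    ← Circle.exp_add, Circle.exp_eq_exp] at h
  obtain ⟨m, hm⟩ := h
  have hπ := Real.pi_pos
  have hm1 : (m : ℝ) < 1 := by nlinarith
  have hm2 : (-1 : ℝ) < m := by nlinarith
  have hm0 : m = 0 := by
    have a1 : m < 1 := by exact_mod_cast hm1
    have a2 : -1 < m := by exact_mod_cast hm2
    omega
  rw [hm, hm0]; simp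

/-- With scale `s` and rotation parameter `u`, the eigenvalues match: `su = α` on the orthogonal
complement of the centre and `s conj u = α⁻²` at the centre. -/
theorem specialElliptic_param {h : V →ₗ[ℂ] V →ₗ⋆[ℂ] ℂ} (j : ℕ) (θ : ℝ) (v : V) (hv : v ≠ 0) :
    specialElliptic h (param j θ) (Projectivization.mk ℂ v hv) =
      (scaleParam j θ : ℂ) • rotation h (rotParam θ) v := by
  ext x
  have e₁ : (param j θ : ℂ) = scaleParam j θ * rotParam θ := by
    rw [← scaleParam_mul_rotParam, Circle.coe_mul]
  have e₂ : ((param j θ : ℂ) ^ 2)⁻¹ = scaleParam j θ * conj (rotParam θ : ℂ) := by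
    rw [← Circle.coe_inv_eq_conj, ← Circle.coe_mul, scaleParam_mul_inv_rotParam, Circle.coe_inv,
      Circle.coe_pow]
  rw [specialElliptic_mk, e₂, e₁, LinearMap.smul_apply, rotation_apply]
  module

theorem prod_param {h : V →ₗ[ℂ] V →ₗ⋆[ℂ] ℂ} (j k : ℕ) (θ₁ θ₂ : ℝ) (v₁ v₂ : V) (hv₁ : v₁ ≠ 0)
    (hv₂ : v₂ ≠ 0) :
    Config.prod h ⟨Projectivization.mk ℂ v₁ hv₁, Projectivization.mk ℂ v₂ hv₂, param j θ₁,
      param k θ₂⟩ = ((scaleParam j θ₁ : ℂ) * scaleParam k θ₂) •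
        (rotation h (rotParam θ₂) v₂ * rotation h (rotParam θ₁) v₁) := by
  simp only [Config.prod, specialElliptic_param, smul_mul_smul_comm]
  rw [mul_comm]

/-! ### The theorem -/

theorem mul_pos_of_sign_eq {a b : ℝ} (h : SignType.sign a = SignType.sign b)
    (ha : SignType.sign a ≠ 0) : 0 < a * b := by
  rw [← sign_eq_one_iff, sign_mul, ← h]
  cases hs : SignType.sign a
  · exact absurd hs ha
  · rfl
  · rfl

/-- Two generic configurations with equal products, equal signatures and parameters in the same
arcs are related by an f-bending followed by a bending, unless their lines are orthogonal. -/
theorem exists_fBending {h : V →ₗ[ℂ] V →ₗ⋆[ℂ] ℂ} (hh : HasSignatureTwoOne h) {X Y : Config V}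
    (hX : X.Generic h) (hY : Y.Generic h) (hσ₁ : signature h X.p₁ = signature h Y.p₁)
    (hσ₂ : signature h X.p₂ = signature h Y.p₂) (hαβ₁ : SameComponent X.α₁ Y.α₁)
    (hαβ₂ : SameComponent X.α₂ Y.α₂)
    (hL : ¬ OrthogonalLines h (line X.p₁ X.p₂) (line Y.p₁ Y.p₂))
    (hrel : X.prod h = Y.prod h) :
    ∃ Z, IsFBending h X Z ∧ IsBending h Z Y := by
  obtain ⟨v₁, v₂, hv₁, hv₂, n₁, n₂, r, ep₁, ep₂, hG, sp₁, sp₂, hP⟩ := hX.exists_normalPair hh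
  obtain ⟨w₁, w₂, hw₁, hw₂, m₁, m₂, s, eq₁, eq₂, -, sq₁, sq₂, hQ⟩ := hY.exists_normalPair hh
  obtain ⟨j, ⟨θ₁, tp₁, tl₁, eα₁⟩, φ₁, fp₁, fl₁, eβ₁⟩ := id hαβ₁
  obtain ⟨k, ⟨θ₂, tp₂, tl₂, eα₂⟩, φ₂, fp₂, fl₂, eβ₂⟩ := id hαβ₂
  change X.α₁ = param j θ₁ at eα₁
  change Y.α₁ = param j φ₁ at eβ₁
  change X.α₂ = param k θ₂ at eα₂
  change Y.α₂ = param k φ₂ at eβ₂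
  have P := hP (rotParam θ₁) (rotParam θ₂) (rotParam_im_pos tp₁ tl₁) (rotParam_im_pos tp₂ tl₂)
  have Q := hQ (rotParam φ₁) (rotParam φ₂) (rotParam_im_pos fp₁ fl₁) (rotParam_im_pos fp₂ fl₂)
  clear hP hQ
  have hXR : X.prod h = ((scaleParam j θ₁ : ℂ) * scaleParam k θ₂) •
      (rotation h (rotParam θ₂) v₂ * rotation h (rotParam θ₁) v₁) := by
    rw [← prod_param j k θ₁ θ₂ v₁ v₂ hv₁ hv₂, ← ep₁, ← ep₂, ← eα₁, ← eα₂]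
  have hYR : Y.prod h = ((scaleParam j φ₁ : ℂ) * scaleParam k φ₂) •
      (rotation h (rotParam φ₂) w₂ * rotation h (rotParam φ₁) w₁) := by
    rw [← prod_param j k φ₁ φ₂ w₁ w₂ hw₁ hw₂, ← eq₁, ← eq₂, ← eβ₁, ← eβ₂]
  -- the two planes are equal
  obtain ⟨c, hc, hv₁c, hv₂c, hspan⟩ := hh.exists_polar (v₁ := v₁) (v₂ := v₂) (by
    rw [P.self₁, P.self₂, P.cross, P.cross', ← sq]; exact_mod_cast P.disc)
  obtain ⟨c', hc', hw₁c', hw₂c', hspan'⟩ := hh.exists_polar (v₁ := w₁) (v₂ := w₂) (by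
    rw [Q.self₁, Q.self₂, Q.cross, Q.cross', ← sq]; exact_mod_cast Q.disc)
  have hsymm : ∀ {x y : V}, h x y = 0 → h y x = 0 := fun {x y} hx => by
    rw [← hh.conj_symm, hx, map_zero]
  -- If `c` were orthogonal to `c'`, the polar point of the first line would lie on the second one.
  have hcc' : h c c' ≠ 0 := by
    intro h0
    apply hL
    intro c₀ hc₀
    rw [ep₁, ep₂] at hc₀
    rw [eq₁, eq₂, mem_line_mk]
    have h1 : h c₀ v₁ = 0 := hc₀ v₁ (mem_line_mk.2 ⟨1, 0, by simp⟩)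
    have h2 : h c₀ v₂ = 0 := hc₀ v₂ (mem_line_mk.2 ⟨0, 1, by simp⟩)
    set z := h c₀ c / h c c with hz
    have hp : h (c₀ - z • c) c = 0 := by
      rw [map_sub, map_smul, LinearMap.sub_apply, LinearMap.smul_apply, smul_eq_mul, hz,
        div_mul_cancel₀ _ hc, sub_self]
    obtain ⟨a, b, hab⟩ := hspan _ hp
    have hab0 := P.eq_zero_of_orthogonal (a := a) (b := b)
      (by rw [← hab]; simp [h1, hsymm hv₁c]) (by rw [← hab]; simp [h2, hsymm hv₂c])
    have hcz : c₀ = z • c := by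
      rw [hab0.1, hab0.2, zero_smul, zero_smul, add_zero, sub_eq_zero] at hab
      exact hab
    exact hspan' c₀ (by rw [hcz, map_smul, LinearMap.smul_apply, h0, smul_zero])
  have hunit : ∀ a b : Circle, (a * b : ℂ) * conj (a * b : ℂ) = 1 := fun a b => by
    rw [← Circle.coe_mul, Complex.mul_conj, Circle.normSq_coe, Complex.ofReal_one]
  obtain ⟨hδ, hw₁c, hw₂c⟩ := P.same_plane hh Q (hunit _ _) (hunit _ _)
    (hXR.symm.trans (hrel.trans hYR)) hc hv₁c hv₂c hspan hw₁c' hw₂c' hcc'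
  -- the parameters
  have hαβ : X.α₁ * X.α₂ = Y.α₁ * Y.α₂ := by
    rw [eα₁, eα₂, eβ₁, eβ₂, ← scaleParam_mul_rotParam, ← scaleParam_mul_rotParam,
      ← scaleParam_mul_rotParam, ← scaleParam_mul_rotParam]
    rw [mul_mul_mul_comm, mul_mul_mul_comm (scaleParam j φ₁)]
    exact Circle.ext (by simpa only [Circle.coe_mul] using hδ)
  -- Equality of the actual angle sums, not only modulo `2π`, is needed: the scales involve
  -- half-angles and could otherwise differ by a sign.
  have hsum : θ₁ + θ₂ = φ₁ + φ₂ := by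
    rw [eα₁, eα₂, eβ₁, eβ₂] at hαβ
    exact add_eq_add_of_param_mul_eq hαβ tp₁ tl₁ tp₂ tl₂ fp₁ fl₁ fp₂ fl₂
  have hscale : scaleParam j θ₁ * scaleParam k θ₂ = scaleParam j φ₁ * scaleParam k φ₂ := by
    simp only [scaleParam]
    rw [mul_mul_mul_comm, mul_mul_mul_comm _ _ _ (Circle.exp (-(φ₂ / 2))), ← Circle.exp_add,
      ← Circle.exp_add]
    congr 2
    linarith
  have hu : (rotParam θ₁ : ℂ) * rotParam θ₂ = rotParam φ₁ * rotParam φ₂ := by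
    have hscale' : (scaleParam j θ₁ : ℂ) * scaleParam k θ₂ = scaleParam j φ₁ * scaleParam k φ₂ := by
      rw [← Circle.coe_mul, hscale, Circle.coe_mul]
    rw [← hscale'] at hδ
    exact mul_left_cancel₀ (mul_ne_zero (Circle.coe_ne_zero _) (Circle.coe_ne_zero _)) hδ
  obtain ⟨l, hl⟩ : ∃ l : ℂ, l = (scaleParam j θ₁ : ℂ) * scaleParam k θ₂ := ⟨_, rfl⟩
  have hl0 : l ≠ 0 := by
    rw [hl]; exact mul_ne_zero (Circle.coe_ne_zero _) (Circle.coe_ne_zero _)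
  have hl' : (scaleParam j φ₁ : ℂ) * scaleParam k φ₂ = l := by
    rw [hl, ← Circle.coe_mul, ← hscale, Circle.coe_mul]
  obtain ⟨S, hS⟩ : ∃ S, rotation h (rotParam θ₂) v₂ * rotation h (rotParam θ₁) v₁ = S := ⟨_, rfl⟩
  rw [← hl, hS] at hXR
  rw [hl'] at hYR
  have hS' : rotation h (rotParam φ₂) w₂ * rotation h (rotParam φ₁) w₁ = S :=
    smul_right_injective _ hl0 (hYR.symm.trans (hrel.symm.trans hXR))
  obtain ⟨τ, hτ⟩ : ∃ τ, halfTrace (rotParam θ₁) (rotParam θ₂) n₁ n₂ r = τ := ⟨_, rfl⟩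
  obtain ⟨A, hA⟩ : ∃ A, skewPart S τ = A := ⟨_, rfl⟩
  have hs₁ : 0 < m₁ * n₁ := by
    refine mul_pos_of_sign_eq (by rw [← sq₁, ← sp₁, hσ₁]) ?_
    rw [← sq₁]; exact hY.nonisotropic₁
  have hs₂ : 0 < m₂ * n₂ := by
    refine mul_pos_of_sign_eq (by rw [← sq₂, ← sp₂, hσ₂]) ?_
    rw [← sq₂]; exact hY.nonisotropic₂
  obtain ⟨D, hD, hDS, ⟨ρ₁, x₁, y₁, hD₁, hN₁⟩, ρ₂, x₂, y₂, hD₂, hN₂⟩ :=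
    P.exists_isometry hh Q hS hS' hτ hA hu hs₁ hs₂ hc hv₁c hv₂c hw₁c hspan
  have hDh := hD.1
  have had : IsAdapted h c A (1 - τ ^ 2) := by
    have := P.isAdapted hv₁c hv₂c hspan
    rwa [hS, hτ, hA] at this
  have hAeq : A = skewPart (rotation h (rotParam θ₂) v₂ * rotation h (rotParam θ₁) v₁)
      (halfTrace (rotParam θ₁) (rotParam θ₂) n₁ n₂ r) := by rw [hS, hτ, hA]
  have hDw₁ : D w₁ ≠ 0 := D.map_ne_zero_iff.2 hw₁
  have hDw₂ : D w₂ ≠ 0 := D.map_ne_zero_iff.2 hw₂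
  have seg₁ := had.segment hh hv₁c hv₁ (fun μ => by rw [hAeq]; exact P.skewPart_ne_smul₁ μ) hN₁
    hDw₁ hD₁ (by rw [hDh, Q.self₁, P.self₁]; exact hs₁)
  have seg₂ := had.segment hh hv₂c hv₂ (fun μ => by rw [hAeq]; exact P.skewPart_ne_smul₂ μ) hN₂
    hDw₂ hD₂ (by rw [hDh, Q.self₂, P.self₂]; exact hs₂)
  have hfix : ∀ x, IsFixedPoint (X.prod h) x → IsFixedPoint A x := by
    intro x hx
    induction x using Projectivization.ind with | h v hv => ?_
    rw [isFixedPoint_mk] at hx ⊢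
    obtain ⟨μ, hμ⟩ := hx
    rw [hXR, LinearMap.smul_apply] at hμ
    refine ⟨-Complex.I * (l⁻¹ * μ - τ), ?_⟩
    have : S v = (l⁻¹ * μ) • v := by rw [mul_smul, ← hμ, inv_smul_smul₀ hl0]
    rw [← hA, skewPart_apply, this]
    module
  have hDX : ∀ x, D (X.prod h x) = X.prod h (D x) := fun x => by
    rw [hXR, LinearMap.smul_apply, LinearMap.smul_apply, map_smul, hDS]
  -- The intermediate configuration is the `D`-image of `Y`. Its product is again that of `X`, since
  -- `D` commutes with it.
  obtain ⟨Z, hZ⟩ : ∃ Z : Config V, Z = ⟨act D Y.p₁, act D Y.p₂, Y.α₁, Y.α₂⟩ := ⟨_, rfl⟩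
  have hZX : X.prod h = Z.prod h := by
    ext x
    obtain ⟨x, rfl⟩ := D.surjective x
    rw [hZ, Config.prod_act hDh, ← hrel, hDX]
  have ez₁ : Z.p₁ = Projectivization.mk ℂ (D w₁) hDw₁ := by rw [hZ, eq₁]; rfl
  have ez₂ : Z.p₂ = Projectivization.mk ℂ (D w₂) hDw₂ := by rw [hZ, eq₂]; rfl
  have hang : ∀ θ : ℝ, 0 < θ → θ < 2 * Real.pi / 3 →
      0 ≤ Complex.arg ((Circle.exp (θ / 2) : ℂ) ^ 3) ∧
        Complex.arg ((Circle.exp (θ / 2) : ℂ) ^ 3) < Real.pi ∧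
        (Circle.exp (Complex.arg ((Circle.exp (θ / 2) : ℂ) ^ 3)) : ℂ) = rotParam θ := by
    intro θ h0 h1
    have him := rotParam_im_pos h0 h1
    have e : (rotParam θ : ℂ) = (Circle.exp (θ / 2) : ℂ) ^ 3 := by rw [rotParam, Circle.coe_pow]
    refine ⟨?_, ?_, ?_⟩
    · rw [← e]; exact Complex.arg_nonneg_iff.2 him.le
    · rw [← e]
      refine lt_of_le_of_ne (Complex.arg_le_pi _) fun h2 => ?_
      rw [Complex.arg_eq_pi_iff] at h2
      exact him.ne' h2.2
    · rw [← e, Circle.exp_arg]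
  refine ⟨Z, ⟨hX, ?_, hZX, ?_, ?_, ?_, ?_, ?_, ?_, ?_, ?_, ?_, ?_⟩, ?_⟩
  · rw [hZ]; exact hY.act hDh
  · obtain ⟨g₁, g₂, g₃⟩ := hang θ₁ tp₁ tl₁
    obtain ⟨g₁', g₂', g₃'⟩ := hang θ₂ tp₂ tl₂
    refine ⟨_, _, _, ⟨rfl, Circle.exp (θ₁ / 2), Circle.exp (θ₂ / 2), ?_, ?_, ?_, ?_⟩,
      ez₁ ▸ P.mem_realSpan₁ hAeq hDw₁ hD₁, ez₂ ▸ P.mem_realSpan₂ hAeq hDw₂ hD₂⟩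
    · rw [eα₁]; exact isPrimitive_param j tp₁ tl₁
    · rw [eα₂]; exact isPrimitive_param k tp₂ tl₂
    · rw [hG, ep₁]; exact P.hasAngle₁ g₁ g₂ g₃
    · rw [hG, ep₂]; exact P.hasAngle₂ g₁' g₂' g₃'
  · rw [hZ, hσ₁]; exact signature_act hDh _
  · rw [hZ, hσ₂]; exact signature_act hDh _
  · rw [ep₁, ez₁, orthogonal_mk]; exact seg₁.1
  · rw [ep₂, ez₂, orthogonal_mk]; exact seg₂.1
  · rw [hZ]; exact hαβ
  · rw [hZ]; exact hαβ₁
  · rw [hZ]; exact hαβ₂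
  · rw [ep₁, ez₁]; exact fun x hx hf => seg₁.2 x hx (hfix x hf)
  · rw [ep₂, ez₂]; exact fun x hx hf => seg₂.2 x hx (hfix x hf)
  · refine ⟨D⁻¹, (SU h).inv_mem hD, ?_, ?_⟩
    · rw [← hZX]
      ext x
      obtain ⟨x, rfl⟩ := D.surjective x
      change D.symm (X.prod h (D x)) = X.prod h (D.symm (D x))
      rw [← hDX, D.symm_apply_apply, D.symm_apply_apply]
    · rw [hZ, act_symm_act, act_symm_act]

end ComplexHyperbolic

end

theorem mainTheorem3 {V : Type*} [AddCommGroup V] [Module ℂ V]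
    (h : V →ₗ[ℂ] V →ₗ⋆[ℂ] ℂ) (hh : ComplexHyperbolic.HasSignatureTwoOne h)
    (p₁ p₂ q₁ q₂ : ℙ ℂ V) (α₁ α₂ β₁ β₂ : Circle)
    (hp : p₁ ≠ p₂) (hq : q₁ ≠ q₂)
    (hp₁ : ComplexHyperbolic.signature h p₁ ≠ 0) (hp₂ : ComplexHyperbolic.signature h p₂ ≠ 0)
    (hq₁ : ComplexHyperbolic.signature h q₁ ≠ 0) (hq₂ : ComplexHyperbolic.signature h q₂ ≠ 0)
    (hpo : ¬ ComplexHyperbolic.Orthogonal h p₁ p₂) (hqo : ¬ ComplexHyperbolic.Orthogonal h q₁ q₂)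
    (hσ₁ : ComplexHyperbolic.signature h p₁ = ComplexHyperbolic.signature h q₁)
    (hσ₂ : ComplexHyperbolic.signature h p₂ = ComplexHyperbolic.signature h q₂)
    (hα₁ : α₁ ∉ ComplexHyperbolic.Omega) (hα₂ : α₂ ∉ ComplexHyperbolic.Omega)
    (hβ₁ : β₁ ∉ ComplexHyperbolic.Omega) (hβ₂ : β₂ ∉ ComplexHyperbolic.Omega)
    (hαβ₁ : ComplexHyperbolic.SameComponent α₁ β₁) (hαβ₂ : ComplexHyperbolic.SameComponent α₂ β₂)
    (hLp : ¬ ComplexHyperbolic.IsEuclidean h (ComplexHyperbolic.line p₁ p₂))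
    (hLq : ¬ ComplexHyperbolic.IsEuclidean h (ComplexHyperbolic.line q₁ q₂))
    (hL : ¬ ComplexHyperbolic.OrthogonalLines h (ComplexHyperbolic.line p₁ p₂)
      (ComplexHyperbolic.line q₁ q₂))
    (hrel : ComplexHyperbolic.specialElliptic h α₂ p₂ * ComplexHyperbolic.specialElliptic h α₁ p₁ =
      ComplexHyperbolic.specialElliptic h β₂ q₂ * ComplexHyperbolic.specialElliptic h β₁ q₁) :
    ComplexHyperbolic.FollowsFromBendings h ⟨p₁, p₂, α₁, α₂⟩ ⟨q₁, q₂, β₁, β₂⟩ := by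
  obtain ⟨Z, hXZ, hZY⟩ := ComplexHyperbolic.exists_fBending hh (X := ⟨p₁, p₂, α₁, α₂⟩)
    (Y := ⟨q₁, q₂, β₁, β₂⟩) ⟨hp, hp₁, hp₂, hpo, hLp, hα₁, hα₂⟩ ⟨hq, hq₁, hq₂, hqo, hLq, hβ₁, hβ₂⟩
    hσ₁ hσ₂ hαβ₁ hαβ₂ hL hrel
  exact .tail (.single (Or.inr hXZ)) (Or.inl hZY)
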